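/- Let $k$ be a field of characteristic zero, let $r\ge 0$ and let $T=(k^\times)^r$ be an algebraic torus. Let $\mathtt{DGA}_k^+$ be the category of non-negatively graded differential graded (unital, associative) $k$-algebras, with differentials of degree $-1$. In $\mathtt{DGA}_k^+$ the weak equivalences are the quasi-isomorphisms, the fibrations are the morphisms that are surjective in every (strictly) positive degree, and the cofibrations are the morphisms with the left lifting property with respect to all morphisms that are both weak equivalences and fibrations (the projective model structure). A rational action of $T$ on $A\in\mathtt{DGA}_k^+$ is a group homomorphism $T\to\mathrm{Aut}_{\mathtt{DGA}_k^+}(A)$ such that every $a\in A$ lies in a finite-dimensional $T$-stable subspace $V\subset A$ on which the induced action $T\to \mathrm{GL}_k(V)$ is a morphism of algebraic groups (its matrix coefficients are Laurent polynomials in the coordinates of $T$). Let $(\mathtt{DGA}_k^+)^T$ be the category of objects of $\mathtt{DGA}_k^+$ with a rational $T$-action and $T$-equivariant morphisms, and let $U:(\mathtt{DGA}_k^+)^T\to\mathtt{DGA}_k^+$ be the functor forgetting the action. Theorem 2.15. There exists a model structure on $(\mathtt{DGA}_k^+)^T$ with the following properties: (1) A morphism $f$ of $(\mathtt{DGA}_k^+)^T$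 is a weak equivalence (respectively, a fibration) if and only if $U(f)$ is a weak equivalence (respectively, a fibration) in $\mathtt{DGA}_k^+$; and the cofibrations are exactly the morphisms with the left lifting property with respect to the morphisms $p$ such that $U(p)$ is both a weak equivalence and a fibration. (2) $U$ preserves cofibrations: if $f$ is a cofibration in $(\mathtt{DGA}_k^+)^T$, then $U(f)$ is a cofibration in $\mathtt{DGA}_k^+$. -/

import Mathlib

open CategoryTheory HomotopicalAlgebra

universe u

noncomputable section

/-- A non-negatively graded differential graded algebra over `k`: a unital associative `k`-algebra
`A` with a grading `A = ⨁ (n : ℕ), A_n` and a `k`-linear differential of degree `-1` which squares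
to zero and satisfies the graded Leibniz rule. -/
structure DGAlgPlus (k : Type u) [Field k] where
  carrier : Type u
  [ring : Ring carrier]
  [algebra : Algebra k carrier]
  /-- the homogeneous component of each homological degree -/
  gr : ℕ → Submodule k carrier
  [graded : GradedAlgebra gr]
  d : carrier →ₗ[k] carrier
  d_mem : ∀ (n : ℕ) (a : carrier), a ∈ gr (n + 1) → d a ∈ gr n
  d_zero : ∀ a : carrier, a ∈ gr 0 → d a = 0
  d_d : ∀ a : carrier, d (d a) = 0
  leibniz : ∀ (n : ℕ) (a b : carrier), a ∈ gr n → d (a * b) = d a * b + (-1) ^ n * (a * d b)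

namespace DGAlgPlus

variable {k : Type u} [Field k]

instance : CoeSort (DGAlgPlus k) (Type u) := ⟨carrier⟩

attribute [instance] ring algebra graded

/-- Morphisms: unital algebra homomorphisms of degree zero which commute with the differentials. -/
@[ext]
structure Hom (A B : DGAlgPlus k) where
  toAlgHom : A →ₐ[k] B
  map_mem : ∀ (n : ℕ) (a : A), a ∈ A.gr n → toAlgHom a ∈ B.gr n
  map_d : ∀ a : A, toAlgHom (A.d a) = B.d (toAlgHom a)

/-- The category `DGA_k^+`. -/
instance : Category (DGAlgPlus k) where
  Hom A B := Hom A B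
  id A :=
    { toAlgHom := AlgHom.id k A
      map_mem := fun _ _ h => h
      map_d := fun _ => rfl }
  comp f g :=
    { toAlgHom := g.toAlgHom.comp f.toAlgHom
      map_mem := fun n a h => g.map_mem n _ (f.map_mem n a h)
      map_d := fun a => by simp [f.map_d, g.map_d] }

/-- The differential `A_{n+1} → A_n`. -/
def dComp (A : DGAlgPlus k) (n : ℕ) : A.gr (n + 1) →ₗ[k] A.gr n :=
  A.d.restrict (A.d_mem n)

/-- The map `A_n → B_n` induced by a morphism `A ⟶ B`. -/
def Hom.inDegree {A B : DGAlgPlus k} (f : A ⟶ B) (n : ℕ) : A.gr n →ₗ[k] B.gr n :=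
  f.toAlgHom.toLinearMap.restrict (f.map_mem n)

/-- The underlying chain complex `⋯ → A_2 → A_1 → A_0` of vector spaces. -/
def toChainComplex (A : DGAlgPlus k) : ChainComplex (ModuleCat.{u} k) ℕ :=
  ChainComplex.of (fun n => ModuleCat.of k (A.gr n)) (fun n => ModuleCat.ofHom (A.dComp n))
    (fun n => by
      ext a
      exact A.d_d a)

theorem toChainComplex_d (A : DGAlgPlus k) (n : ℕ) :
    A.toChainComplex.d (n + 1) n = ModuleCat.ofHom (A.dComp n) :=
  ChainComplex.of_d (fun n => ModuleCat.of k (A.gr n)) (fun n => ModuleCat.ofHom (A.dComp n)) n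

theorem dComp_comp_inDegree {A B : DGAlgPlus k} (f : A ⟶ B) (n : ℕ) :
    B.dComp n ∘ₗ Hom.inDegree f (n + 1) = Hom.inDegree f n ∘ₗ A.dComp n := by
  ext a
  exact (f.map_d a).symm

variable (k) in
/-- The functor from `DGA_k^+` to chain complexes which forgets the multiplication. -/
def chainFunctor : DGAlgPlus k ⥤ ChainComplex (ModuleCat.{u} k) ℕ where
  obj A := A.toChainComplex
  map {A B} f :=
    ChainComplex.ofHom (X := A.toChainComplex) (Y := B.toChainComplex)
      (fun n => ModuleCat.ofHom (Hom.inDegree f n)) (fun n => by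
        rw [toChainComplex_d, toChainComplex_d]
        exact ModuleCat.hom_ext (dComp_comp_inDegree f n))
  map_id A := by
    ext n a
    rfl
  map_comp f g := by
    ext n a
    rfl

variable (k) in
/-- The weak equivalences of `DGA_k^+`: the quasi-isomorphisms. -/
def weq : MorphismProperty (DGAlgPlus k) :=
  (HomologicalComplex.quasiIso (ModuleCat.{u} k) (ComplexShape.down ℕ)).inverseImage
    (chainFunctor k)

variable (k) in
/-- The fibrations of `DGA_k^+`: the morphisms which are surjective in all positive degrees. -/
def fib : MorphismProperty (DGAlgPlus k) :=
  fun A B f => ∀ n : ℕ, 0 < n → ∀ b ∈ B.gr n, ∃ a ∈ A.gr n, f.toAlgHom a = b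

variable (k) in
/-- The cofibrations of `DGA_k^+`: the morphisms with the left lifting property with respect to
all acyclic fibrations. -/
def cof : MorphismProperty (DGAlgPlus k) :=
  (weq k ⊓ fib k).llp

end DGAlgPlus

/-- The algebraic torus `T = (kˣ)^r`. -/
abbrev AlgTorus (k : Type u) [Field k] (r : ℕ) : Type u := Fin r → kˣ

namespace AlgTorus

variable {k : Type u} [Field k] {r : ℕ}

/-- The character `t ↦ t^n = t_1^{n_1} ⋯ t_r^{n_r}` of weight `n ∈ ℤ^r`. -/
def character (n : Fin r → ℤ) (t : AlgTorus k r) : k :=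
  ((∏ i, t i ^ n i : kˣ) : k)

/-- Regular functions on `T`: those given by Laurent polynomials `∑ c_n t^n`. -/
def IsRegular (f : AlgTorus k r → k) : Prop :=
  ∃ P : (Fin r → ℤ) →₀ k, ∀ t, f t = P.sum fun n c => c * character n t

/-- The homomorphism `T → GL(V)` given by the representation `σ` is a morphism of algebraic groups:
all its matrix coefficients are regular functions on `T`. (The inverse of the determinant is then
regular as well, being the determinant of `σ` at the inverse.) Used for `V` finite dimensional. -/
def IsAlgebraic {V : Type u} [AddCommGroup V] [Module k V]
    (σ : Representation k (AlgTorus k r) V) : Prop :=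
  ∀ (l : Module.Dual k V) (v : V), IsRegular fun t => l (σ t v)

end AlgTorus

namespace DGAlgPlus

variable (k : Type u) [Field k] (r : ℕ)

variable {k r} in
/-- The linear representation of `T` on the total space of a dg-algebra on which `T` acts by
endomorphisms (hence automorphisms) in `DGA_k^+`. -/
def rep (A : Action (DGAlgPlus k) (AlgTorus k r)) :
    Representation k (AlgTorus k r) A.V where
  toFun t := (A.ρ t : A.V ⟶ A.V).toAlgHom.toLinearMap
  map_one' := by
    rw [map_one]
    rfl
  map_mul' s t := by
    rw [map_mul]
    rfl

/-- An action of `T` on a dg-algebra is rational if every element lies in a finite dimensional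
`T`-stable subspace on which the action is a morphism of algebraic groups `T → GL(V)`. -/
def IsRational : ObjectProperty (Action (DGAlgPlus k) (AlgTorus k r)) :=
  fun A => ∀ a : A.V, ∃ V : Subrepresentation (rep A),
    a ∈ V ∧ FiniteDimensional k V.toSubmodule ∧ AlgTorus.IsAlgebraic V.toRepresentation

/-- The category `(DGA_k^+)^T` of dg-algebras with a rational action of `T = (kˣ)^r` and
equivariant morphisms. -/
abbrev Equivariant := (IsRational k r).FullSubcategory

/-- The forgetful functor `U : (DGA_k^+)^T ⥤ DGA_k^+`. -/
def forgetAction : Equivariant k r ⥤ DGAlgPlus k :=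
  (IsRational k r).ι ⋙ Action.forget (DGAlgPlus k) (AlgTorus k r)

end DGAlgPlus

end

/-!
Let `W` be the character group `ℤ ^ r` of the torus `T`. In characteristic zero the ground field is
infinite, so distinct characters of `T` are linearly independent functions, and a rational action of
`T` on a dg-algebra is the same thing as a `W`-grading compatible with the homological grading, the
product and the differential. This is the equivalence `DGAlgPlus.components` between dg-algebras
with a rational action and graded dg-algebras `GradedDGA k W`; the latter are families of vector
spaces indexed by `ℤ × W`, which keeps all constructions free of actions and of direct sums. A
morphism is a quasi-isomorphism, or surjective in positive degrees, if and only if it is so in each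
weight (`DGAlgPlus.weq_components_iff`, `DGAlgPlus.fib_components_iff`). It therefore suffices to
construct the projective model structure on `GradedDGA k W` and to transport it.

The axioms for `GradedDGA k W` are obtained as follows.

* Graded dg-algebras are the models of a multi-sorted algebraic theory. The algebra
  `GradedDGA.presented` given by generators and relations may also carry partial operations
  `lift z b`, defined for a cycle `z` and a symbol `b`, with the axiom `d (lift z b) = z`.
* The acyclic fibrations are the morphisms which lift against the inclusions of spheres into discs
  (`GradedDGA.tfib_iff`). For `f : A ⟶ B`, let `GradedDGA.cofExt f` be the universal algebra under
  `A` and over `B` with an operation which solves all these lifting problems. The projection to `B`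
  is then an acyclic fibration by construction. The map from `A` has the left lifting property with
  respect to an acyclic fibration `t : X ⟶ Y` (`GradedDGA.cofExtι_llp`): the fibre product of `X`
  and `cofExt f` over `Y` admits such operations too, compatibly with the projection to `cofExt f`,
  so the universal property yields a section of this projection. This replaces the small object
  argument.
* Adjoining free generators for all elements of positive degree of `B` gives the other
  factorization, `GradedDGA.acofExt`.
* A morphism with the left lifting property with respect to all fibrations is a weak equivalence, by
  means of a path object made of upper triangular matrices (`GradedDGA.path`,
  `GradedDGA.weq_of_fib_llp`).

Forgetting the weights has a right adjoint `DGAlgPlus.cofree`, a copy of the given dg-algebra in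
each weight. It visibly preserves acyclic fibrations (`DGAlgPlus.tfib_cofreeMap`), so forgetting
the action preserves cofibrations.
-/

open Limits

noncomputable section

/-! ### Externally graded dg-algebras -/

/-- The degree-weight `(1, 0)`, by which differentials lower the index. -/
def shiftDeg (W : Type) [AddCommGroup W] : ℤ × W := (1, 0)

local notation "δ" => shiftDeg _

@[simp] theorem shiftDeg_fst (W : Type) [AddCommGroup W] : (shiftDeg W).1 = 1 := rfl

/-- A dg-algebra over `k` with an additional grading by weights in `W`, as a family of vector spaces
`X (n, w)` vanishing for `n < 0`. The multiplication and the differential take a proof that the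
indices match, so that the axioms can be stated without transport along equalities of indices. -/
structure GradedDGA (k : Type u) [Field k] (W : Type) [AddCommGroup W] where
  X : ℤ × W → Type u
  [addCommGroup : ∀ g, AddCommGroup (X g)]
  [module : ∀ g, Module k (X g)]
  one : X 0
  mul : ∀ {g h i : ℤ × W}, g + h = i → (X g →ₗ[k] X h →ₗ[k] X i)
  d : ∀ {i j : ℤ × W}, j + shiftDeg W = i → (X i →ₗ[k] X j)
  one_mul : ∀ {g : ℤ × W} (e : 0 + g = g) (x : X g), mul e one x = x
  mul_one : ∀ {g : ℤ × W} (e : g + 0 = g) (x : X g), mul e x one = x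
  mul_assoc : ∀ {a b c ab bc abc : ℤ × W} (e₁ : a + b = ab) (e₂ : ab + c = abc) (e₃ : b + c = bc)
    (e₄ : a + bc = abc) (x : X a) (y : X b) (z : X c),
    mul e₂ (mul e₁ x y) z = mul e₄ x (mul e₃ y z)
  d_d : ∀ {a b c : ℤ × W} (e₁ : b + shiftDeg W = a) (e₂ : c + shiftDeg W = b) (x : X a),
    d e₂ (d e₁ x) = 0
  leibniz : ∀ {a b c a' b' c' : ℤ × W} (e : a + b = c) (ea : a' + shiftDeg W = a)
    (eb : b' + shiftDeg W = b) (ec : c' + shiftDeg W = c) (e₁ : a' + b = c') (e₂ : a + b' = c')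
    (x : X a) (y : X b),
    d ec (mul e x y) = mul e₁ (d ea x) y + (-1 : k) ^ a.1 • mul e₂ x (d eb y)
  eq_zero : ∀ g : ℤ × W, g.1 < 0 → ∀ x : X g, x = 0

namespace GradedDGA

variable {k : Type u} [Field k] {W : Type} [AddCommGroup W]

attribute [instance] addCommGroup module

/-- Morphisms of graded dg-algebras. -/
@[ext]
structure Hom (A B : GradedDGA k W) where
  app : ∀ g, A.X g →ₗ[k] B.X g
  map_one : app 0 A.one = B.one
  map_mul : ∀ {g h i : ℤ × W} (e : g + h = i) (x : A.X g) (y : A.X h),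
    app i (A.mul e x y) = B.mul e (app g x) (app h y)
  map_d : ∀ {i j : ℤ × W} (e : j + shiftDeg W = i) (x : A.X i), app j (A.d e x) = B.d e (app i x)

instance : Category (GradedDGA k W) where
  Hom A B := Hom A B
  id A :=
    { app := fun _ => LinearMap.id
      map_one := rfl
      map_mul := fun _ _ _ => rfl
      map_d := fun _ _ => rfl }
  comp f g :=
    { app := fun i => (g.app i).comp (f.app i)
      map_one := by simp [f.map_one, g.map_one]
      map_mul := fun e x y => by simp [f.map_mul, g.map_mul]
      map_d := fun e x => by simp [f.map_d, g.map_d] }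

variable {A B C : GradedDGA k W}

/-- The component of a morphism in a given degree and weight. -/
def app (f : A ⟶ B) (g : ℤ × W) : A.X g →ₗ[k] B.X g := Hom.app f g

theorem map_one (f : A ⟶ B) : app f 0 A.one = B.one := Hom.map_one f

theorem map_mul (f : A ⟶ B) {g h i : ℤ × W} (e : g + h = i) (x : A.X g) (y : A.X h) :
    app f i (A.mul e x y) = B.mul e (app f g x) (app f h y) := Hom.map_mul f e x y

theorem map_d (f : A ⟶ B) {i j : ℤ × W} (e : j + shiftDeg W = i) (x : A.X i) :
    app f j (A.d e x) = B.d e (app f i x) := Hom.map_d f e x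

@[simp] theorem id_app (g : ℤ × W) (x : A.X g) : app (𝟙 A) g x = x := rfl

@[simp] theorem comp_app (f : A ⟶ B) (f' : B ⟶ C) (g : ℤ × W) (x : A.X g) :
    app (f ≫ f') g x = app f' g (app f g x) := rfl

theorem congr_app {f f' : A ⟶ B} (h : f = f') (g : ℤ × W) (x : A.X g) :
    app f g x = app f' g x := by rw [h]

theorem hom_ext {f f' : A ⟶ B} (h : ∀ g x, app f g x = app f' g x) : f = f' :=
  Hom.ext (funext fun g => LinearMap.ext fun x => h g x)

theorem isIso_of_bijective (f : A ⟶ B) (hf : ∀ g, Function.Bijective (app f g)) : IsIso f := by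
  let e : ∀ g, A.X g ≃ₗ[k] B.X g := fun g => LinearEquiv.ofBijective (app f g) (hf g)
  have he : ∀ g x, (e g) x = app f g x := fun g x => rfl
  let r : Hom B A :=
    { app := fun g => (e g).symm.toLinearMap
      map_one := by
        simp only [LinearEquiv.coe_coe]
        rw [LinearEquiv.symm_apply_eq, he, map_one]
      map_mul := fun e' x y => by
        simp only [LinearEquiv.coe_coe]
        rw [LinearEquiv.symm_apply_eq, he, map_mul, ← he, ← he]
        simp
      map_d := fun e' x => by
        simp only [LinearEquiv.coe_coe]
        rw [LinearEquiv.symm_apply_eq, he, map_d, ← he]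
        simp }
  refine ⟨⟨(r : B ⟶ A), hom_ext fun g x => ?_, hom_ext fun g x => ?_⟩⟩
  · exact (e g).symm_apply_apply x
  · exact (e g).apply_symm_apply x

/-! ### Weak equivalences and fibrations of graded dg-algebras -/

variable (k W) in
/-- The fibrations: the morphisms which are surjective in positive homological degrees. -/
def fib : MorphismProperty (GradedDGA k W) :=
  fun A B f => ∀ g : ℤ × W, 0 < g.1 → ∀ b : B.X g, ∃ a : A.X g, app f g a = b

variable (k W) in
/-- The weak equivalences, that is, the quasi-isomorphisms, described by injectivity and
surjectivity on homology in each degree and weight. -/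
def weq : MorphismProperty (GradedDGA k W) :=
  fun A B f => ∀ ⦃h i j : ℤ × W⦄ (e : i + δ = h) (e' : j + δ = i),
    (∀ a : A.X i, A.d e' a = 0 → (∃ b : B.X h, B.d e b = app f i a) → ∃ x : A.X h, A.d e x = a) ∧
    ∀ b : B.X i, B.d e' b = 0 →
      ∃ (a : A.X i) (y : B.X h), A.d e' a = 0 ∧ b = app f i a + B.d e y

variable (k W) in
/-- The morphisms for which every lifting problem against the inclusion of a sphere into a disc
(of any degree and weight) has a solution. -/
def tfib : MorphismProperty (GradedDGA k W) :=
  fun A B f => ∀ ⦃h i j : ℤ × W⦄ (e : i + δ = h) (e' : j + δ = i) (z : A.X i) (b : B.X h),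
    A.d e' z = 0 → app f i z = B.d e b → ∃ x : A.X h, A.d e x = z ∧ app f h x = b

theorem sub_shiftDeg (g : ℤ × W) : g - δ + δ = g := sub_add_cancel _ _

theorem tfib.exists_cycle {f : A ⟶ B} (hf : tfib k W f) {i j : ℤ × W} (e : j + δ = i) (b : B.X i)
    (hb : B.d e b = 0) : ∃ a : A.X i, A.d e a = 0 ∧ app f i a = b :=
  hf e (sub_shiftDeg j) 0 b (by simp) (by simp [hb])

theorem tfib.surjective {f : A ⟶ B} (hf : tfib k W f) {i : ℤ × W} (b : B.X i) :
    ∃ a : A.X i, app f i a = b := by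
  obtain ⟨z, hz, hz'⟩ := hf.exists_cycle (sub_shiftDeg (i - δ)) (B.d (sub_shiftDeg i) b)
    (B.d_d _ _ _)
  obtain ⟨a, -, ha⟩ := hf (sub_shiftDeg i) (sub_shiftDeg (i - δ)) z b hz hz'
  exact ⟨a, ha⟩

/-- The acyclic fibrations are the morphisms with the right lifting property with respect to the
inclusions of spheres into discs. In homological degree `0` this contains the surjectivity, which is
not part of the definition of a fibration. -/
theorem tfib_iff (f : A ⟶ B) : tfib k W f ↔ weq k W f ∧ fib k W f := by
  constructor
  · intro hf
    refine ⟨fun h i j e e' => ⟨fun a ha hb => ?_, fun b hb => ?_⟩, fun g _ b => hf.surjective b⟩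
    · obtain ⟨b, hb⟩ := hb
      obtain ⟨x, hx, -⟩ := hf e e' a b ha hb.symm
      exact ⟨x, hx⟩
    · obtain ⟨a, ha, ha'⟩ := hf.exists_cycle e' b hb
      exact ⟨a, 0, ha, by simp [ha']⟩
  · rintro ⟨hw, hf⟩ h i j e e' z b hz hzb
    by_cases hi : i.1 < -1
    · have hh : h.1 < 0 := by have := congrArg Prod.fst e; simp at this; omega
      exact ⟨0, by rw [A.eq_zero i (by omega) z, _root_.map_zero],
        by rw [B.eq_zero h hh b, _root_.map_zero]⟩
    have hh : 0 < h.1 + 1 := by have := congrArg Prod.fst e; simp at this; omega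
    -- First solve the problem up to a cycle of `B`, then correct by a cycle of `A` and a boundary.
    obtain ⟨x₀, hx₀⟩ := (hw e e').1 z hz ⟨b, hzb.symm⟩
    obtain ⟨a, y, ha, hay⟩ := (hw (h := h + δ) (i := h) (j := i) rfl e).2 (b - app f h x₀) (by
      rw [_root_.map_sub, ← map_d, hx₀, hzb, sub_self])
    obtain ⟨y', hy'⟩ := hf (h + δ) (by simpa using hh) y
    refine ⟨x₀ + a + A.d rfl y', ?_, ?_⟩
    · rw [_root_.map_add, _root_.map_add, hx₀, ha, A.d_d, add_zero, add_zero]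
    · rw [_root_.map_add, _root_.map_add, map_d, hy', add_assoc, ← hay, add_sub_cancel]

theorem tfib_eq : tfib k W = weq k W ⊓ fib k W := by
  ext A B f
  exact tfib_iff f

theorem weq_comp {f : A ⟶ B} {f' : B ⟶ C} (hf : weq k W f) (hf' : weq k W f') :
    weq k W (f ≫ f') := by
  refine fun h i j e e' => ⟨fun a ha hb => ?_, fun c hc => ?_⟩
  · obtain ⟨b, hb⟩ := (hf' e e').1 (app f _ a) (by rw [← map_d, ha, _root_.map_zero]) hb
    exact (hf e e').1 a ha ⟨b, hb⟩
  · obtain ⟨b, y, hb, rfl⟩ := (hf' e e').2 c hc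
    obtain ⟨a, x, ha, rfl⟩ := (hf e e').2 b hb
    refine ⟨a, app f' _ x + y, ha, ?_⟩
    rw [_root_.map_add, _root_.map_add, comp_app, map_d, add_assoc]

theorem weq_of_precomp {f : A ⟶ B} {f' : B ⟶ C} (hf : weq k W f) (hff' : weq k W (f ≫ f')) :
    weq k W f' := by
  refine fun h i j e e' => ⟨fun b hb hc => ?_, fun c hc => ?_⟩
  · obtain ⟨c, hc⟩ := hc
    obtain ⟨a, y, ha, rfl⟩ := (hf e e').2 b hb
    obtain ⟨x, rfl⟩ := (hff' e e').1 a ha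
      ⟨c - app f' h y, by rw [_root_.map_sub, hc, _root_.map_add, ← map_d, comp_app]; simp⟩
    exact ⟨app f _ x + y, by rw [_root_.map_add, map_d]⟩
  · obtain ⟨a, y, ha, rfl⟩ := (hff' e e').2 c hc
    exact ⟨app f _ a, y, by rw [← map_d, ha, _root_.map_zero], rfl⟩

theorem weq_of_postcomp {f : A ⟶ B} {f' : B ⟶ C} (hf' : weq k W f') (hff' : weq k W (f ≫ f')) :
    weq k W f := by
  refine fun h i j e e' => ⟨fun a ha hb => ?_, fun b hb => ?_⟩
  · obtain ⟨b, hb⟩ := hb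
    exact (hff' e e').1 a ha ⟨app f' _ b, by rw [← map_d, hb, comp_app]⟩
  · obtain ⟨a, y, ha, hay⟩ := (hff' e e').2 (app f' _ b) (by rw [← map_d, hb, _root_.map_zero])
    obtain ⟨x, hx⟩ := (hf' e e').1 (b - app f _ a)
      (by rw [_root_.map_sub, ← map_d, ha, hb, _root_.map_zero, sub_zero])
      ⟨y, by rw [_root_.map_sub, hay, comp_app, add_sub_cancel_left]⟩
    exact ⟨a, x, ha, by rw [hx, add_sub_cancel]⟩

instance : (weq k W).HasTwoOutOfThreeProperty where
  comp_mem _ _ := weq_comp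
  of_postcomp _ _ := weq_of_postcomp
  of_precomp _ _ := weq_of_precomp

/-! ### Finite limits of graded dg-algebras -/

variable (k W) in
/-- The zero algebra. -/
def trivial : GradedDGA k W where
  X _ := PUnit
  one := 0
  mul _ := 0
  d _ := 0
  one_mul _ _ := rfl
  mul_one _ _ := rfl
  mul_assoc _ _ _ _ _ _ _ := rfl
  d_d _ _ _ := rfl
  leibniz _ _ _ _ _ _ _ _ := rfl
  eq_zero _ _ _ := rfl

instance (A : GradedDGA k W) : Unique (A ⟶ trivial k W) where
  default :=
    ({ app := fun _ => 0
       map_one := rfl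
       map_mul := fun _ _ _ => rfl
       map_d := fun _ _ => rfl } : Hom A (trivial k W))
  uniq _ := hom_ext fun _ _ => rfl

instance : HasTerminal (GradedDGA k W) := hasTerminal_of_unique (trivial k W)

/-- The fibre product of graded dg-algebras. -/
def fiberProd (f : A ⟶ C) (f' : B ⟶ C) : GradedDGA k W where
  X g := LinearMap.eqLocus ((app f g).comp (LinearMap.fst k (A.X g) (B.X g)))
    ((app f' g).comp (LinearMap.snd k (A.X g) (B.X g)))
  one := ⟨(A.one, B.one), by simp [map_one]⟩
  mul e := LinearMap.mk₂ k
    (fun x y => ⟨(A.mul e x.1.1 y.1.1, B.mul e x.1.2 y.1.2), by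
      have hx := x.2
      have hy := y.2
      simp only [LinearMap.mem_eqLocus, LinearMap.comp_apply, LinearMap.fst_apply,
        LinearMap.snd_apply] at hx hy ⊢
      rw [map_mul, map_mul, hx, hy]⟩)
    (fun _ _ _ => Subtype.ext (by simp)) (fun _ _ _ => Subtype.ext (by simp))
    (fun _ _ _ => Subtype.ext (by simp)) (fun _ _ _ => Subtype.ext (by simp))
  d e := LinearMap.restrict ((A.d e).prodMap (B.d e)) (fun x hx => by
    simp only [LinearMap.mem_eqLocus, LinearMap.comp_apply, LinearMap.fst_apply,
      LinearMap.snd_apply, LinearMap.prodMap_apply] at hx ⊢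
    rw [map_d, map_d, hx])
  one_mul e x := Subtype.ext (Prod.ext (A.one_mul e _) (B.one_mul e _))
  mul_one e x := Subtype.ext (Prod.ext (A.mul_one e _) (B.mul_one e _))
  mul_assoc e₁ e₂ e₃ e₄ x y z :=
    Subtype.ext (Prod.ext (A.mul_assoc e₁ e₂ e₃ e₄ _ _ _) (B.mul_assoc e₁ e₂ e₃ e₄ _ _ _))
  d_d e₁ e₂ x := Subtype.ext (Prod.ext (A.d_d e₁ e₂ _) (B.d_d e₁ e₂ _))
  leibniz e ea eb ec e₁ e₂ x y :=
    Subtype.ext (Prod.ext (A.leibniz e ea eb ec e₁ e₂ _ _) (B.leibniz e ea eb ec e₁ e₂ _ _))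
  eq_zero g hg x := Subtype.ext (Prod.ext (A.eq_zero g hg _) (B.eq_zero g hg _))

/-- The first projection of a fibre product. -/
def fiberFst (f : A ⟶ C) (f' : B ⟶ C) : fiberProd f f' ⟶ A :=
  ({ app := fun _ => (LinearMap.fst k _ _).comp (Submodule.subtype _)
     map_one := rfl
     map_mul := fun _ _ _ => rfl
     map_d := fun _ _ => rfl } : Hom (fiberProd f f') A)

/-- The second projection of a fibre product. -/
def fiberSnd (f : A ⟶ C) (f' : B ⟶ C) : fiberProd f f' ⟶ B :=
  ({ app := fun _ => (LinearMap.snd k _ _).comp (Submodule.subtype _)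
     map_one := rfl
     map_mul := fun _ _ _ => rfl
     map_d := fun _ _ => rfl } : Hom (fiberProd f f') B)

/-- The element of a fibre product with given components. -/
def fiberMk (f : A ⟶ C) (f' : B ⟶ C) {g : ℤ × W} (a : A.X g) (b : B.X g)
    (h : app f g a = app f' g b) : (fiberProd f f').X g := ⟨(a, b), h⟩

@[simp] theorem fiberFst_mk (f : A ⟶ C) (f' : B ⟶ C) {g : ℤ × W} (a : A.X g) (b : B.X g)
    (h : app f g a = app f' g b) : app (fiberFst f f') g (fiberMk f f' a b h) = a := rfl

@[simp] theorem fiberSnd_mk (f : A ⟶ C) (f' : B ⟶ C) {g : ℤ × W} (a : A.X g) (b : B.X g)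
    (h : app f g a = app f' g b) : app (fiberSnd f f') g (fiberMk f f' a b h) = b := rfl

theorem fiber_ext (f : A ⟶ C) (f' : B ⟶ C) {g : ℤ × W} {x y : (fiberProd f f').X g}
    (h₁ : app (fiberFst f f') g x = app (fiberFst f f') g y)
    (h₂ : app (fiberSnd f f') g x = app (fiberSnd f f') g y) : x = y :=
  Subtype.ext (Prod.ext h₁ h₂)

theorem fiber_condition (f : A ⟶ C) (f' : B ⟶ C) :
    fiberFst f f' ≫ f = fiberSnd f f' ≫ f' :=
  hom_ext fun _ x => x.2

/-- The morphism to a fibre product with given components. -/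
def fiberLift (f : A ⟶ C) (f' : B ⟶ C) {P : GradedDGA k W} (a : P ⟶ A) (b : P ⟶ B)
    (h : a ≫ f = b ≫ f') : P ⟶ fiberProd f f' :=
  ({ app := fun g => ((app a g).prod (app b g)).codRestrict _ (fun x => congr_app h g x)
     map_one := fiber_ext f f' (map_one a) (map_one b)
     map_mul := fun e x y => fiber_ext f f' (map_mul a e x y) (map_mul b e x y)
     map_d := fun e x => fiber_ext f f' (map_d a e x) (map_d b e x) } : Hom P (fiberProd f f'))

instance : HasPullbacks (GradedDGA k W) := by
  have (A B C : GradedDGA k W) (f : A ⟶ C) (f' : B ⟶ C) : HasLimit (cospan f f') := ⟨⟨{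
    cone := PullbackCone.mk (fiberFst f f') (fiberSnd f f') (fiber_condition f f')
    isLimit := PullbackCone.IsLimit.mk _ (fun s => fiberLift f f' s.fst s.snd s.condition)
      (fun _ => rfl) (fun _ => rfl)
      (fun s m h₁ h₂ => hom_ext fun g x =>
        fiber_ext f f' (congr_app h₁ g x) (congr_app h₂ g x)) }⟩⟩
  exact hasPullbacks_of_hasLimit_cospan _

instance : HasFiniteLimits (GradedDGA k W) := hasFiniteLimits_of_hasTerminal_and_pullbacks

end GradedDGA

/-! ### Graded dg-algebras presented by generators, lifting operations and relations -/

namespace GradedDGA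

variable {k : Type u} [Field k] {W : Type} [AddCommGroup W]

variable (k) in
/-- Formal expressions in the operations of a graded dg-algebra, in generators from `E`, and in
additional partial operations `lift z o`, whose symbols `o` are taken from `O`. -/
inductive Term (E O : ℤ × W → Type u) : ℤ × W → Type u
  | gen {g : ℤ × W} (x : E g) : Term E O g
  | zero {g : ℤ × W} : Term E O g
  | add {g : ℤ × W} (x y : Term E O g) : Term E O g
  | smul {g : ℤ × W} (c : k) (x : Term E O g) : Term E O g
  | one : Term E O 0
  | mul {g h i : ℤ × W} (e : g + h = i) (x : Term E O g) (y : Term E O h) : Term E O i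
  | d {i j : ℤ × W} (e : j + shiftDeg W = i) (x : Term E O i) : Term E O j
  | lift {i j : ℤ × W} (e : i + shiftDeg W = j) (z : Term E O i) (o : O j) : Term E O j

namespace Term

variable {E O : ℤ × W → Type u}

/-- The value of an expression in a graded dg-algebra, given values of the generators and an
interpretation of the operations `lift`. -/
def eval (Y : GradedDGA k W) (v : ∀ g, E g → Y.X g)
    (l : ∀ i j : ℤ × W, Y.X i → O j → Y.X j) : ∀ {g : ℤ × W}, Term k E O g → Y.X g
  | _, gen x => v _ x
  | _, zero => 0
  | _, add x y => eval Y v l x + eval Y v l y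
  | _, smul c x => c • eval Y v l x
  | _, one => Y.one
  | _, mul e x y => Y.mul e (eval Y v l x) (eval Y v l y)
  | _, d e x => Y.d e (eval Y v l x)
  | _, lift _ z o => l _ _ (eval Y v l z) o

/-- The congruence on expressions generated by the axioms of graded dg-algebras, the relations `R`,
and the equations `d (lift z o) = z` for those cycles `z` and symbols `o` which satisfy the
condition `P`. -/
inductive Rel (P : ∀ i j : ℤ × W, Term k E O i → O j → Prop)
    (R : ∀ g : ℤ × W, Term k E O g → Term k E O g → Prop) :
    ∀ g : ℤ × W, Term k E O g → Term k E O g → Prop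
  | refl {g} (x) : Rel P R g x x
  | symm {g x y} : Rel P R g x y → Rel P R g y x
  | trans {g x y z} : Rel P R g x y → Rel P R g y z → Rel P R g x z
  | add_congr {g x x' y y'} : Rel P R g x x' → Rel P R g y y' → Rel P R g (add x y) (add x' y')
  | smul_congr {g c x x'} : Rel P R g x x' → Rel P R g (smul c x) (smul c x')
  | mul_congr {g h i x x' y y'} (e : g + h = i) :
      Rel P R g x x' → Rel P R h y y' → Rel P R i (mul e x y) (mul e x' y')
  | d_congr {i j x x'} (e : j + shiftDeg W = i) : Rel P R i x x' → Rel P R j (d e x) (d e x')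
  | lift_congr {i j z z'} (e : i + shiftDeg W = j) (o : O j) :
      Rel P R i z z' → Rel P R j (lift e z o) (lift e z' o)
  | add_comm {g} (x y) : Rel P R g (add x y) (add y x)
  | add_assoc {g} (x y z) : Rel P R g (add (add x y) z) (add x (add y z))
  | zero_add {g} (x) : Rel P R g (add zero x) x
  | zero_smul {g} (x) : Rel P R g (smul 0 x) zero
  | one_smul {g} (x) : Rel P R g (smul 1 x) x
  | mul_smul {g} (a b x) : Rel P R g (smul (a * b) x) (smul a (smul b x))
  | add_smul {g} (a b x) : Rel P R g (smul (a + b) x) (add (smul a x) (smul b x))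
  | smul_add {g} (a x y) : Rel P R g (smul a (add x y)) (add (smul a x) (smul a y))
  | add_mul {g h i} (e : g + h = i) (x x' y) :
      Rel P R i (mul e (add x x') y) (add (mul e x y) (mul e x' y))
  | mul_add {g h i} (e : g + h = i) (x y y') :
      Rel P R i (mul e x (add y y')) (add (mul e x y) (mul e x y'))
  | smul_mul {g h i} (e : g + h = i) (c x y) : Rel P R i (mul e (smul c x) y) (smul c (mul e x y))
  | mul_smul' {g h i} (e : g + h = i) (c x y) : Rel P R i (mul e x (smul c y)) (smul c (mul e x y))
  | d_add {i j} (e : j + shiftDeg W = i) (x y) : Rel P R j (d e (add x y)) (add (d e x) (d e y))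
  | d_smul {i j} (e : j + shiftDeg W = i) (c x) : Rel P R j (d e (smul c x)) (smul c (d e x))
  | one_mul {g} (e : 0 + g = g) (x) : Rel P R g (mul e one x) x
  | mul_one {g} (e : g + 0 = g) (x) : Rel P R g (mul e x one) x
  | mul_assoc {a b c ab bc abc : ℤ × W} (e₁ : a + b = ab) (e₂ : ab + c = abc) (e₃ : b + c = bc)
      (e₄ : a + bc = abc) (x y z) :
      Rel P R abc (mul e₂ (mul e₁ x y) z) (mul e₄ x (mul e₃ y z))
  | d_d {a b c : ℤ × W} (e₁ : b + shiftDeg W = a) (e₂ : c + shiftDeg W = b) (x) :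
      Rel P R c (d e₂ (d e₁ x)) zero
  | leibniz {a b c a' b' c' : ℤ × W} (e : a + b = c) (ea : a' + shiftDeg W = a)
      (eb : b' + shiftDeg W = b) (ec : c' + shiftDeg W = c) (e₁ : a' + b = c') (e₂ : a + b' = c')
      (x y) :
      Rel P R c' (d ec (mul e x y))
        (add (mul e₁ (d ea x) y) (smul ((-1) ^ a.1) (mul e₂ x (d eb y))))
  | eq_zero {g} (h : g.1 < 0) (x) : Rel P R g x zero
  | lift_d {h i j} (e : i + shiftDeg W = h) (e' : j + shiftDeg W = i) (z : Term k E O i) (o : O h) :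
      Rel P R j (d e' z) zero → P i h z o → Rel P R i (d e (lift e z o)) z
  | of {g x y} : R g x y → Rel P R g x y

variable {P : ∀ i j : ℤ × W, Term k E O i → O j → Prop}
  {R : ∀ g : ℤ × W, Term k E O g → Term k E O g → Prop}

/-- A sufficient condition for interpretations of the generators and the operations to respect
all relations. -/
structure Models (P : ∀ i j : ℤ × W, Term k E O i → O j → Prop)
    (R : ∀ g : ℤ × W, Term k E O g → Term k E O g → Prop) (Y : GradedDGA k W)
    (v : ∀ g, E g → Y.X g) (l : ∀ i j : ℤ × W, Y.X i → O j → Y.X j) : Prop where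
  rel : ∀ {g} {x y : Term k E O g}, R g x y → eval Y v l x = eval Y v l y
  lift_d : ∀ {h i j} (e : i + shiftDeg W = h) (e' : j + shiftDeg W = i) (z : Term k E O i)
    (o : O h), Y.d e' (eval Y v l z) = 0 → P i h z o → Y.d e (l i h (eval Y v l z) o) = eval Y v l z

theorem Models.eval_eq {Y : GradedDGA k W} {v : ∀ g, E g → Y.X g}
    {l : ∀ i j : ℤ × W, Y.X i → O j → Y.X j} (hY : Models P R Y v l) {g : ℤ × W}
    {x y : Term k E O g} (h : Rel P R g x y) : eval Y v l x = eval Y v l y := by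
  induction h with
  | refl => rfl
  | symm _ ih => exact ih.symm
  | trans _ _ ih ih' => exact ih.trans ih'
  | add_congr _ _ ih ih' => simp only [eval, ih, ih']
  | smul_congr _ ih => simp only [eval, ih]
  | mul_congr _ _ _ ih ih' => simp only [eval, ih, ih']
  | d_congr _ _ ih => simp only [eval, ih]
  | lift_congr _ _ _ ih => simp only [eval, ih]
  | add_comm => exact _root_.add_comm _ _
  | add_assoc => exact _root_.add_assoc _ _ _
  | zero_add => exact _root_.zero_add _
  | zero_smul => exact _root_.zero_smul _ _
  | one_smul => exact _root_.one_smul _ _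
  | mul_smul => exact SemigroupAction.mul_smul _ _ _
  | add_smul => exact _root_.add_smul _ _ _
  | smul_add => exact _root_.smul_add _ _ _
  | add_mul => simp only [eval, _root_.map_add, LinearMap.add_apply]
  | mul_add => simp only [eval, _root_.map_add]
  | smul_mul => simp only [eval, _root_.map_smul, LinearMap.smul_apply]
  | mul_smul' => simp only [eval, _root_.map_smul]
  | d_add => simp only [eval, _root_.map_add]
  | d_smul => simp only [eval, _root_.map_smul]
  | one_mul => exact Y.one_mul _ _
  | mul_one => exact Y.mul_one _ _
  | mul_assoc e₁ e₂ e₃ e₄ => exact Y.mul_assoc e₁ e₂ e₃ e₄ _ _ _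
  | d_d => exact Y.d_d _ _ _
  | leibniz e ea eb ec e₁ e₂ => exact Y.leibniz e ea eb ec e₁ e₂ _ _
  | eq_zero h => exact Y.eq_zero _ h _
  | lift_d e e' z o _ hP ih => exact hY.lift_d e e' z o ih hP
  | of h => exact hY.rel h

variable (P R) in
/-- The congruence `Rel` as a setoid. -/
def relSetoid (g : ℤ × W) : Setoid (Term k E O g) :=
  ⟨Rel P R g, .refl, .symm, .trans⟩

end Term

section Presented

open Term

variable {E O : ℤ × W → Type u} (P : ∀ i j : ℤ × W, Term k E O i → O j → Prop)
  (R : ∀ g : ℤ × W, Term k E O g → Term k E O g → Prop)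

/-- A homogeneous component of the graded dg-algebra given by a presentation. -/
def PresentedComp (g : ℤ × W) : Type u := Quotient (relSetoid P R g)

namespace PresentedComp

variable {P R}

/-- The class of an expression. -/
def toComp {g : ℤ × W} (x : Term k E O g) : PresentedComp P R g := Quotient.mk _ x

theorem mk_surjective {g : ℤ × W} (q : PresentedComp P R g) : ∃ x, toComp x = q :=
  Quotient.exists_rep q

theorem sound {g : ℤ × W} {x y : Term k E O g} (h : Rel P R g x y) :
    (toComp x : PresentedComp P R g) = toComp y := Quotient.sound h

theorem exact {g : ℤ × W} {x y : Term k E O g} (h : (toComp x : PresentedComp P R g) = toComp y) :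
    Rel P R g x y := Quotient.exact h

instance (g : ℤ × W) : Add (PresentedComp P R g) :=
  ⟨Quotient.map₂ add fun _ _ h _ _ h' => .add_congr h h'⟩

instance (g : ℤ × W) : Zero (PresentedComp P R g) := ⟨toComp zero⟩

instance (g : ℤ × W) : SMul k (PresentedComp P R g) :=
  ⟨fun c => Quotient.map (smul c) fun _ _ h => .smul_congr h⟩

instance (g : ℤ × W) : Neg (PresentedComp P R g) := ⟨fun x => (-1 : k) • x⟩

instance (g : ℤ × W) : AddCommMonoid (PresentedComp P R g) where
  add_assoc := by rintro ⟨x⟩ ⟨y⟩ ⟨z⟩; exact sound (.add_assoc x y z)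
  zero_add := by rintro ⟨x⟩; exact sound (.zero_add x)
  add_zero := by rintro ⟨x⟩; exact sound ((Rel.add_comm _ _).trans (.zero_add x))
  add_comm := by rintro ⟨x⟩ ⟨y⟩; exact sound (.add_comm x y)
  nsmul := nsmulRec

instance (g : ℤ × W) : AddCommGroup (PresentedComp P R g) where
  zsmul := zsmulRec
  neg_add_cancel := by
    rintro ⟨x⟩
    refine sound (.trans (.trans (.add_congr (.refl _) (.symm (.one_smul x)))
      (.symm (.add_smul (-1) 1 x))) ?_)
    rw [neg_add_cancel]
    exact .zero_smul x
  add_comm := add_comm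

instance (g : ℤ × W) : Module k (PresentedComp P R g) :=
  Module.ofMinimalAxioms (by rintro c ⟨x⟩ ⟨y⟩; exact sound (.smul_add c x y))
    (by rintro a b ⟨x⟩; exact sound (.add_smul a b x))
    (by rintro a b ⟨x⟩; exact sound (.mul_smul a b x))
    (by rintro ⟨x⟩; exact sound (.one_smul x))

end PresentedComp

open PresentedComp

/-- The graded dg-algebra with generators `E`, operations `lift` satisfying `d (lift z o) = z`
for cycles `z` under the condition `P`, and relations `R`. -/
def presented : GradedDGA k W where
  X := PresentedComp P R
  one := toComp Term.one
  mul e := LinearMap.mk₂ k (Quotient.map₂ (Term.mul e) fun _ _ h _ _ h' => .mul_congr e h h')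
    (by rintro ⟨x⟩ ⟨x'⟩ ⟨y⟩; exact sound (.add_mul e x x' y))
    (by rintro c ⟨x⟩ ⟨y⟩; exact sound (.smul_mul e c x y))
    (by rintro ⟨x⟩ ⟨y⟩ ⟨y'⟩; exact sound (.mul_add e x y y'))
    (by rintro c ⟨x⟩ ⟨y⟩; exact sound (.mul_smul' e c x y))
  d e :=
    { toFun := Quotient.map (Term.d e) fun _ _ h => .d_congr e h
      map_add' := by rintro ⟨x⟩ ⟨y⟩; exact sound (.d_add e x y)
      map_smul' := by rintro c ⟨x⟩; exact sound (.d_smul e c x) }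
  one_mul e := by rintro ⟨x⟩; exact sound (.one_mul e x)
  mul_one e := by rintro ⟨x⟩; exact sound (.mul_one e x)
  mul_assoc e₁ e₂ e₃ e₄ := by rintro ⟨x⟩ ⟨y⟩ ⟨z⟩; exact sound (.mul_assoc e₁ e₂ e₃ e₄ x y z)
  d_d e₁ e₂ := by rintro ⟨x⟩; exact sound (.d_d e₁ e₂ x)
  leibniz e ea eb ec e₁ e₂ := by rintro ⟨x⟩ ⟨y⟩; exact sound (.leibniz e ea eb ec e₁ e₂ x y)
  eq_zero g h := by rintro ⟨x⟩; exact sound (.eq_zero h x)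

variable {P R}

/-- The class of an expression in the algebra given by a presentation. -/
def cls {g : ℤ × W} (x : Term k E O g) : (presented P R).X g := PresentedComp.toComp x

theorem cls_surjective {g : ℤ × W} (q : (presented P R).X g) : ∃ x, cls x = q := mk_surjective q

/-- The operation `lift` on the algebra given by a presentation. -/
def presentedLift {i j : ℤ × W} (e : i + δ = j) (z : (presented P R).X i) (o : O j) :
    (presented P R).X j :=
  Quotient.map (fun z => lift e z o) (fun _ _ h => .lift_congr e o h) z

theorem d_presentedLift {h i j : ℤ × W} (e : i + δ = h) (e' : j + δ = i) (z : Term k E O i)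
    (o : O h)
    (hz : (presented P R).d e' (cls z) = 0) (hP : P i h z o) :
    (presented P R).d e (presentedLift e (cls z) o) = cls z :=
  PresentedComp.sound (.lift_d e e' z o (PresentedComp.exact hz) hP)

/-- The morphism from the algebra given by a presentation to an algebra in which the relations
hold. -/
def presentedDesc {Y : GradedDGA k W} {v : ∀ g, E g → Y.X g}
    {l : ∀ i j : ℤ × W, Y.X i → O j → Y.X j} (hY : Models P R Y v l) : presented P R ⟶ Y :=
  ({ app := fun g =>
      { toFun := Quotient.lift (eval Y v l) fun _ _ h => hY.eval_eq h
        map_add' := by rintro ⟨x⟩ ⟨y⟩; rfl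
        map_smul' := by rintro c ⟨x⟩; rfl }
     map_one := rfl
     map_mul := by rintro g h i e ⟨x⟩ ⟨y⟩; rfl
     map_d := by rintro i j e ⟨x⟩; rfl } : Hom (presented P R) Y)

/-- Morphisms from the algebra given by a presentation are determined by their values on the
generators, provided that they are compatible with the operations `lift`. -/
theorem presented_hom_ext {Y : GradedDGA k W} {f f' : presented P R ⟶ Y}
    (hgen : ∀ g (x : E g), app f g (cls (gen x)) = app f' g (cls (gen x)))
    (hlift : ∀ {i j : ℤ × W} (e : i + δ = j) (z : (presented P R).X i) (o : O j),
      app f i z = app f' i z → app f j (presentedLift e z o) = app f' j (presentedLift e z o)) :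
    f = f' := by
  refine hom_ext fun g q => ?_
  obtain ⟨x, rfl⟩ := cls_surjective q
  induction x with
  | gen x => exact hgen _ x
  | zero => exact (_root_.map_zero (app f _)).trans (_root_.map_zero (app f' _)).symm
  | add x y ih ih' =>
    exact (_root_.map_add (app f _) _ _).trans
      ((congrArg₂ _ ih ih').trans (_root_.map_add (app f' _) _ _).symm)
  | smul c x ih =>
    exact (_root_.map_smul (app f _) _ _).trans
      ((congrArg _ ih).trans (_root_.map_smul (app f' _) _ _).symm)
  | one => exact (map_one f).trans (map_one f').symm
  | mul e x y ih ih' =>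
    exact (map_mul f e _ _).trans ((congrArg₂ (fun a b => Y.mul e a b) ih ih').trans
      (map_mul f' e _ _).symm)
  | d e x ih => exact (map_d f e _).trans ((congrArg (Y.d e) ih).trans (map_d f' e _).symm)
  | lift e z o ih => exact hlift e _ o ih

end Presented

/-! ### Finite colimits of graded dg-algebras -/

section HomRel

open Term

variable {E O : ℤ × W → Type u}

/-- The relations which say that `s` is a morphism of graded dg-algebras from `A`. -/
inductive HomRel (A : GradedDGA k W) (s : ∀ g, A.X g → Term k E O g) :
    ∀ g : ℤ × W, Term k E O g → Term k E O g → Prop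
  | add {g} (x y : A.X g) : HomRel A s g (s g (x + y)) (add (s g x) (s g y))
  | smul {g} (c : k) (x : A.X g) : HomRel A s g (s g (c • x)) (smul c (s g x))
  | one : HomRel A s 0 (s 0 A.one) Term.one
  | mul {g h i} (e : g + h = i) (x : A.X g) (y : A.X h) :
      HomRel A s i (s i (A.mul e x y)) (Term.mul e (s g x) (s h y))
  | d {i j} (e : j + shiftDeg W = i) (x : A.X i) : HomRel A s j (s j (A.d e x)) (Term.d e (s i x))

theorem HomRel.eval_eq {A Y : GradedDGA k W} {s : ∀ g, A.X g → Term k E O g}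
    {v : ∀ g, E g → Y.X g} {l : ∀ i j : ℤ × W, Y.X i → O j → Y.X j} (f : A ⟶ Y)
    (hf : ∀ g x, eval Y v l (s g x) = app f g x) {g : ℤ × W} {x y : Term k E O g}
    (h : HomRel A s g x y) : eval Y v l x = eval Y v l y := by
  cases h with
  | add => simp only [Term.eval, hf, _root_.map_add]
  | smul => simp only [Term.eval, hf, _root_.map_smul]
  | one => simp only [Term.eval, hf, GradedDGA.map_one]
  | mul => simp only [Term.eval, hf, GradedDGA.map_mul]
  | d => simp only [Term.eval, hf, GradedDGA.map_d]

/-- The morphism to a presented algebra given by expressions which satisfy the relations of a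
morphism. -/
def homOfRel {P : ∀ i j : ℤ × W, Term k E O i → O j → Prop}
    {R : ∀ g : ℤ × W, Term k E O g → Term k E O g → Prop} {A : GradedDGA k W}
    (s : ∀ g, A.X g → Term k E O g) (hs : ∀ g x y, HomRel A s g x y → R g x y) :
    A ⟶ presented P R :=
  ({ app := fun g =>
      { toFun := fun x => cls (s g x)
        map_add' := fun x y => PresentedComp.sound (.of (hs _ _ _ (.add x y)))
        map_smul' := fun c x => PresentedComp.sound (.of (hs _ _ _ (.smul c x))) }
     map_one := PresentedComp.sound (.of (hs _ _ _ .one))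
     map_mul := fun e x y => PresentedComp.sound (.of (hs _ _ _ (.mul e x y)))
     map_d := fun e x => PresentedComp.sound (.of (hs _ _ _ (.d e x))) } : Hom A (presented P R))

end HomRel

open Term

/-- The empty set of symbols in each degree and weight. -/
abbrev NoSymbols (_ : ℤ × W) : Type u := PEmpty

instance : HasInitial (GradedDGA k W) := by
  let Q : GradedDGA k W := presented (E := NoSymbols) (O := NoSymbols) (fun _ _ _ _ => True)
    (fun _ _ _ => False)
  have (Y : GradedDGA k W) : Unique (Q ⟶ Y) :=
    { default := presentedDesc (v := fun _ x => x.elim) (l := fun _ _ _ o => o.elim)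
        ⟨fun h => h.elim, fun _ _ _ o => o.elim⟩
      uniq := fun f => presented_hom_ext (fun _ x => x.elim) (fun _ _ o => o.elim) }
  exact hasInitial_of_unique Q

section Pushout

variable {A B C : GradedDGA k W} (f : C ⟶ A) (f' : C ⟶ B)

/-- The relations of a pushout. -/
inductive PushoutRel :
    ∀ g : ℤ × W, Term k (fun g => A.X g ⊕ B.X g) NoSymbols g →
      Term k (fun g => A.X g ⊕ B.X g) NoSymbols g → Prop
  | inl {g x y} : HomRel A (fun _ a => gen (.inl a)) g x y → PushoutRel g x y
  | inr {g x y} : HomRel B (fun _ b => gen (.inr b)) g x y → PushoutRel g x y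
  | glue {g} (c : C.X g) : PushoutRel g (gen (.inl (app f g c))) (gen (.inr (app f' g c)))

theorem pushoutRel_models {Y : GradedDGA k W} (a : A ⟶ Y) (b : B ⟶ Y) (h : f ≫ a = f' ≫ b) :
    Models (fun _ _ _ _ => True) (PushoutRel f f') Y (fun g => Sum.elim (app a g) (app b g))
      (fun _ _ _ o => o.elim) where
  rel h' := by
    cases h' with
    | inl h' => exact h'.eval_eq a fun _ _ => rfl
    | inr h' => exact h'.eval_eq b fun _ _ => rfl
    | glue c => exact congr_app h _ c
  lift_d _ _ _ o := o.elim

instance : HasPushouts (GradedDGA k W) := by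
  have (A B C : GradedDGA k W) (f : C ⟶ A) (f' : C ⟶ B) : HasColimit (span f f') := by
    let Q := presented (fun _ _ _ _ => True) (PushoutRel f f')
    let a : A ⟶ Q := homOfRel (fun _ a => gen (.inl a)) fun _ _ _ => .inl
    let b : B ⟶ Q := homOfRel (fun _ b => gen (.inr b)) fun _ _ _ => .inr
    refine ⟨⟨{
      cocone := PushoutCocone.mk a b
        (hom_ext fun g c => PresentedComp.sound (.of (.glue c)))
      isColimit := PushoutCocone.IsColimit.mk _
        (fun s => presentedDesc (pushoutRel_models f f' s.inl s.inr s.condition))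
        (fun _ => rfl) (fun _ => rfl)
        (fun s m h₁ h₂ => presented_hom_ext (fun g x => ?_) (fun _ _ o => o.elim)) }⟩⟩
    cases x with
    | inl x => exact congr_app h₁ g x
    | inr x => exact congr_app h₂ g x
  exact hasPushouts_of_hasColimit_span _

end Pushout

instance : HasFiniteColimits (GradedDGA k W) := hasFiniteColimits_of_hasInitial_and_pushouts

end GradedDGA

namespace GradedDGA

variable {k : Type u} [Field k] {W : Type} [AddCommGroup W]

/-! ### Factorizations of morphisms of graded dg-algebras -/

section CofTfib

open Term

variable {A B : GradedDGA k W} (f : A ⟶ B)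

/-- The condition under which the lifting problem for a cycle `z` and an element `b` of `B` is
solved formally: `z` is mapped to the boundary of `b`. -/
def LiftCond (i j : ℤ × W) (z : Term k A.X B.X i) (b : B.X j) : Prop :=
  ∀ e : i + shiftDeg W = j, eval B (fun g => app f g) (fun _ _ _ b => b) z = B.d e b

/-- The extension of `A` obtained by adjoining freely solutions of all lifting problems
over `f : A ⟶ B`. -/
def cofExt : GradedDGA k W := presented (LiftCond f) (HomRel A fun _ a => gen a)

/-- The inclusion of `A` into the extension by solutions of all lifting problems. -/
def cofExtι : A ⟶ cofExt f := homOfRel (fun _ a => gen a) fun _ _ _ h => h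

theorem cofExt_models_self : Models (LiftCond f) (HomRel A fun _ a => gen a) B (fun g => app f g)
    (fun _ _ _ b => b) where
  rel h := h.eval_eq f fun _ _ => rfl
  lift_d e _ _ _ _ h := (h e).symm

/-- The projection to `B` of the extension by solutions of all lifting problems. -/
def cofExtπ : cofExt f ⟶ B := presentedDesc (cofExt_models_self f)

theorem cofExt_fac : cofExtι f ≫ cofExtπ f = f := rfl

theorem tfib_cofExtπ : tfib k W (cofExtπ f) := by
  intro h i j e e' z b hz hzb
  obtain ⟨z, rfl⟩ := cls_surjective z
  exact ⟨presentedLift e (cls z) b, d_presentedLift e e' z b hz (fun _ => hzb), rfl⟩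

/-- The inclusion into `cofExt f` has the left lifting property: in the fibre product of a lifting
problem one can choose solutions of lifting problems over `B` compatibly with those in `cofExt f`,
so that the universal property provides a section. -/
theorem cofExtι_llp : (tfib k W).llp (cofExtι f) := by
  intro X Y t ht
  refine ⟨fun {u v} sq => ?_⟩
  let p := fiberSnd t v
  have hp : tfib k W p := by
    intro h i j e e' z q hz hzq
    obtain ⟨x, hx, hx'⟩ := ht e e' (app (fiberFst t v) i z) (app v h q)
      (by rw [← map_d, hz, _root_.map_zero])
      (by rw [← map_d, ← hzq, ← comp_app, fiber_condition, comp_app])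
    exact ⟨fiberMk t v x q hx', fiber_ext _ _ (by rw [map_d, fiberFst_mk, hx])
      (by rw [map_d, fiberSnd_mk, ← hzq]), rfl⟩
  have hlift : ∀ (i h : ℤ × W) (z : (fiberProd t v).X i) (b : B.X h),
      ∃ x : (fiberProd t v).X h, ∀ e : i + δ = h,
        app p h x = presentedLift (P := LiftCond f) e (app p i z) b ∧
        ∀ {j} (e' : j + δ = i), (fiberProd t v).d e' z = 0 →
          app (cofExtπ f) i (app p i z) = B.d e b → (fiberProd t v).d e x = z := by
    intro i h z b
    by_cases e : i + δ = h
    swap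
    · exact ⟨0, fun e' => (e e').elim⟩
    by_cases hz : (fiberProd t v).d (sub_shiftDeg i) z = 0 ∧
        app (cofExtπ f) i (app p i z) = B.d e b
    · have hpz : (cofExt f).d (sub_shiftDeg i) (app p i z) = 0 := by
        rw [← map_d, hz.1, _root_.map_zero]
      have hd : (cofExt f).d e (presentedLift (P := LiftCond f) e (app p i z) b) = app p i z := by
        have hz2 := hz.2
        generalize app p i z = q at hpz hz2 ⊢
        obtain ⟨q, rfl⟩ := cls_surjective q
        exact d_presentedLift e _ q b hpz (fun _ => hz2)
      obtain ⟨x, hx, hx'⟩ := hp e (sub_shiftDeg i) z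
        (presentedLift (P := LiftCond f) e (app p i z) b) hz.1 hd.symm
      exact ⟨x, fun _ => ⟨hx', fun _ _ _ => hx⟩⟩
    · obtain ⟨x, hx⟩ := hp.surjective (presentedLift (P := LiftCond f) e (app p i z) b)
      refine ⟨x, fun _ => ⟨hx, fun {j} e' h₁ h₂ => (hz ⟨?_, h₂⟩).elim⟩⟩
      obtain rfl : j = i - δ := eq_sub_of_add_eq e'
      exact h₁
  choose l hl using hlift
  let w : A ⟶ fiberProd t v := fiberLift t v u (cofExtι f) sq.w
  have heval : ∀ {g} (x : Term k A.X B.X g),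
      app p g (eval (fiberProd t v) (fun g => app w g) l x) = cls x := by
    intro g x
    induction x with
    | gen x => rfl
    | zero => exact _root_.map_zero _
    | add x y ih ih' => exact (_root_.map_add _ _ _).trans (congrArg₂ _ ih ih')
    | smul c x ih => exact (_root_.map_smul _ _ _).trans (congrArg _ ih)
    | one => exact GradedDGA.map_one p
    | mul e x y ih ih' =>
      exact (GradedDGA.map_mul p e _ _).trans
        (congrArg₂ (fun a b => (cofExt f).mul e a b) ih ih')
    | d e x ih => exact (GradedDGA.map_d p e _).trans (congrArg ((cofExt f).d e) ih)
    | lift e z o ih =>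
      exact ((hl _ _ _ o e).1).trans (congrArg (fun q => presentedLift e q o) ih)
  have hmod :
      Models (LiftCond f) (HomRel A fun _ a => gen a) (fiberProd t v) (fun g => app w g) l :=
    { rel := fun h => h.eval_eq w fun _ _ => rfl
      lift_d := fun e e' z o hz hP => (hl _ _ _ o e).2 e' hz (by rw [heval]; exact hP e) }
  let s : cofExt f ⟶ fiberProd t v := presentedDesc hmod
  have hs : s ≫ p = 𝟙 _ := by
    refine hom_ext fun g q => ?_
    obtain ⟨x, rfl⟩ := cls_surjective q
    exact heval x
  have hw : cofExtι f ≫ s = w := rfl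
  exact ⟨⟨{
    l := s ≫ fiberFst t v
    fac_left := by rw [← Category.assoc, hw]; rfl
    fac_right := by rw [Category.assoc, fiber_condition, ← Category.assoc, hs, Category.id_comp] }⟩⟩

end CofTfib

section AcofFib

open Term

variable {A B : GradedDGA k W} (f : A ⟶ B)

/-- The generators of `A` together with one generator for each element of `B` of positive degree. -/
abbrev AcofGen (A B : GradedDGA k W) (g : ℤ × W) : Type u := A.X g ⊕ {_b : B.X g // 0 < g.1}

/-- The extension of `A` obtained by adjoining freely a preimage for each element of `B` of positive
degree. -/
def acofExt (A B : GradedDGA k W) : GradedDGA k W :=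
  presented (E := AcofGen A B) (O := NoSymbols) (fun _ _ _ _ => True)
    (HomRel A fun _ a => gen (.inl a))

/-- The inclusion of `A` into the extension by elements of `B` of positive degree. -/
def acofExtι (A B : GradedDGA k W) : A ⟶ acofExt A B :=
  homOfRel (fun _ a => gen (.inl a)) fun _ _ _ h => h

/-- The morphism from the extension of `A` which is prescribed on `A` and on the additional
generators. -/
def acofExtDesc {Y : GradedDGA k W} (u : A ⟶ Y) (v : ∀ g, {_b : B.X g // 0 < g.1} → Y.X g) :
    acofExt A B ⟶ Y :=
  presentedDesc (v := fun g => Sum.elim (app u g) (v g)) (l := fun _ _ _ o => o.elim)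
    ⟨fun h => h.eval_eq u fun _ _ => rfl, fun _ _ _ o => o.elim⟩

theorem acofExtι_llp : (fib k W).llp (acofExtι A B) := by
  intro X Y t ht
  refine ⟨fun {u v} sq => ?_⟩
  have hx : ∀ (g : ℤ × W) (b : {_b : B.X g // 0 < g.1}), ∃ x : X.X g,
      app t g x = app v g (cls (gen (.inr b))) := fun g b => ht g b.2 _
  choose x hx using hx
  exact ⟨⟨{
    l := acofExtDesc u x
    fac_left := rfl
    fac_right := presented_hom_ext (fun g y => by
      cases y with
      | inl a => exact congr_app sq.w g a
      | inr b => exact hx g b) (fun _ _ o => o.elim) }⟩⟩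

theorem fib_acofExtDesc : fib k W (acofExtDesc f fun _ b => b.1) :=
  fun _ hg b => ⟨cls (gen (.inr ⟨b, hg⟩)), rfl⟩

end AcofFib

/-! ### Homotopies between morphisms of graded dg-algebras -/

section Homotopy

variable {A B : GradedDGA k W} (f f' : A ⟶ B)

/-- The submodule of pairs `(a, h)` which in non-positive degree satisfy the equation
`d h = f a - f' a`, and in negative degree vanish. -/
def pathSubmodule (g : ℤ × W) : Submodule k (A.X g × B.X (g + δ)) where
  carrier := {x | (g.1 ≤ 0 → B.d rfl x.2 = app f g x.1 - app f' g x.1) ∧ (g.1 < 0 → x.2 = 0)}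
  add_mem' {x y} hx hy := by
    refine ⟨fun hg => ?_, fun hg => ?_⟩
    · simp only [Prod.snd_add, Prod.fst_add, _root_.map_add, hx.1 hg, hy.1 hg]
      abel
    · simp [hx.2 hg, hy.2 hg]
  zero_mem' := by simp
  smul_mem' c x hx := by
    refine ⟨fun hg => ?_, fun hg => ?_⟩
    · simp only [Prod.smul_snd, Prod.smul_fst, _root_.map_smul, hx.1 hg, smul_sub]
    · simp [hx.2 hg]

theorem path_mul_mem {g h i : ℤ × W} (e : g + h = i) (e₁ : g + δ + h = i + δ)
    (e₂ : g + (h + δ) = i + δ) (x : pathSubmodule f f' g) (y : pathSubmodule f f' h) :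
    (A.mul e x.1.1 y.1.1, B.mul e₁ x.1.2 (app f' h y.1.1) +
      (-1 : k) ^ g.1 • B.mul e₂ (app f g x.1.1) y.1.2) ∈ pathSubmodule f f' i := by
  have hi : g.1 + h.1 = i.1 := congrArg Prod.fst e
  by_cases hg : g.1 < 0
  · rw [A.eq_zero g hg x.1.1, x.2.2 hg]
    simp only [_root_.map_zero, LinearMap.zero_apply, smul_zero, add_zero]
    exact (pathSubmodule f f' i).zero_mem
  by_cases hh : h.1 < 0
  · rw [A.eq_zero h hh y.1.1, y.2.2 hh]
    simp only [_root_.map_zero, smul_zero, add_zero]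
    exact (pathSubmodule f f' i).zero_mem
  refine ⟨fun hi' => ?_, fun hi' => by omega⟩
  have hg0 : g.1 = 0 := by omega
  have hh0 : h.1 = 0 := by omega
  have e₃ : g + (h - δ) = i - δ := by rw [← e, add_sub_assoc]
  have e₄ : (g - δ) + h = i - δ := by rw [← e]; abel
  have e₅ : (g - δ) + (h + δ) = i := by rw [← e]; abel
  have e₆ : (g + δ) + (h - δ) = i := by rw [← e]; abel
  have hx := x.2.1 hg0.le
  have hy := y.2.1 hh0.le
  dsimp only
  rw [_root_.map_add, _root_.map_smul, B.leibniz e₁ rfl (sub_shiftDeg h) rfl e e₆,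
    B.leibniz e₂ (sub_shiftDeg g) rfl rfl e₅ e,
    B.eq_zero (g - δ) (by simp [hg0]) (B.d _ _), B.eq_zero (h - δ) (by simp [hh0]) (B.d _ _),
    hx, hy, map_mul, map_mul, hg0]
  simp

/-- Transport along an equality of indices, written as the multiplication by the unit. -/
def recast (B : GradedDGA k W) {i j : ℤ × W} (e : i = j) : B.X i →ₗ[k] B.X j :=
  B.mul ((zero_add i).trans e) B.one

@[simp] theorem recast_rfl {i : ℤ × W} (x : B.X i) : recast B rfl x = x := B.one_mul _ x

theorem path_d_mem {i j : ℤ × W} (e : j + shiftDeg W = i) (x : pathSubmodule f f' i) :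
    (A.d e x.1.1, recast B e.symm (app f i x.1.1 - app f' i x.1.1) -
      B.d (congrArg (· + δ) e) x.1.2) ∈ pathSubmodule f f' j := by
  subst e
  refine ⟨fun _ => ?_, fun hj => ?_⟩
  · simp only [recast_rfl, _root_.map_sub, B.d_d, map_d, sub_zero]
  · simp only [recast_rfl]
    rw [x.2.1 (by simp; omega), sub_self]

/-- The path object of two morphisms `f f' : A ⟶ B`: its elements are pairs `(a, h)` of elements of
`A` and `B` of degrees `n` and `n + 1`, viewed as the matrices `!![f a, h; 0, f' a]`, with
differential `(a, h) ↦ (d a, f a - f' a - d h)`, truncated to non-negative degrees. -/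
def path : GradedDGA k W where
  X g := pathSubmodule f f' g
  one := ⟨(A.one, 0), by simp [pathSubmodule, map_one]⟩
  mul {g h i} e := LinearMap.mk₂ k
    (fun x y => ⟨_, path_mul_mem f f' e (by rw [← e, add_right_comm]) (by rw [← e, add_assoc]) x y⟩)
    (fun _ _ _ => Subtype.ext (Prod.ext (by simp) (by simp; abel)))
    (fun _ _ _ => Subtype.ext (Prod.ext (by simp) (by simp [smul_smul, mul_comm])))
    (fun _ _ _ => Subtype.ext (Prod.ext (by simp) (by simp; abel)))
    (fun _ _ _ => Subtype.ext (Prod.ext (by simp) (by simp [smul_smul, mul_comm])))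
  d {i j} e :=
    { toFun := fun x => ⟨_, path_d_mem f f' e x⟩
      map_add' := fun _ _ => Subtype.ext (Prod.ext (by simp) (by simp; abel))
      map_smul' := fun _ _ => Subtype.ext (Prod.ext (by simp) (by simp [smul_sub])) }
  one_mul {g} e x := Subtype.ext (Prod.ext (A.one_mul e _) (by
    simp [map_one, B.one_mul]))
  mul_one {g} e x := Subtype.ext (Prod.ext (A.mul_one e _) (by
    simp [map_one, B.mul_one]))
  mul_assoc {a b c ab bc abc} e₁ e₂ e₃ e₄ x y z :=
    Subtype.ext (Prod.ext (A.mul_assoc e₁ e₂ e₃ e₄ _ _ _) (by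
      have h₁ : a + (b + δ) = ab + δ := by rw [← e₁, add_assoc]
      have h₂ : b + (c + δ) = bc + δ := by rw [← e₃, add_assoc]
      have h₃ : a + (bc + δ) = abc + δ := by rw [← e₄, add_assoc]
      have h₄ : b + δ + c = bc + δ := by rw [← e₃, add_right_comm]
      have h₅ : a + δ + bc = abc + δ := by rw [← e₄, add_right_comm]
      have hab : ab.1 = a.1 + b.1 := (congrArg Prod.fst e₁).symm
      simp only [LinearMap.mk₂_apply, _root_.map_add, LinearMap.add_apply, _root_.map_smul,
        LinearMap.smul_apply, map_mul]
      rw [B.mul_assoc _ _ e₃ h₅, B.mul_assoc h₁ _ h₄ h₃, B.mul_assoc e₁ _ h₂ h₃, hab,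
        zpow_add₀ (by simp)]
      module))
  d_d e₁ e₂ x := Subtype.ext (Prod.ext (A.d_d e₁ e₂ _) (by
    subst e₁ e₂
    simp [map_d, B.d_d]))
  leibniz {a b c a' b' c'} e ea eb ec e₁ e₂ x y :=
    Subtype.ext (Prod.ext (A.leibniz e ea eb ec e₁ e₂ _ _) (by
      subst ea eb ec
      have h₁ : a' + δ + δ + b' = c' + δ := by rw [← e₂]; abel
      have h₂ : a' + (b' + δ + δ) = c' + δ := by rw [← e₁]; abel
      have hε : ((-1 : k) ^ a'.1 * -1) * ((-1 : k) ^ a'.1 * -1) = 1 := by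
        rw [mul_mul_mul_comm, ← mul_zpow]; simp
      simp only [LinearMap.coe_mk, AddHom.coe_mk, LinearMap.mk₂_apply, recast_rfl, _root_.map_add,
        _root_.map_sub, _root_.map_smul, LinearMap.sub_apply, map_mul, Submodule.coe_add,
        Submodule.coe_smul, Prod.snd_add, Prod.smul_snd]
      rw [B.leibniz _ rfl rfl rfl e h₁, B.leibniz _ rfl rfl rfl h₂ e, ← map_d f, ← map_d f']
      simp only [Prod.fst_add, shiftDeg_fst, zpow_add₀ (neg_ne_zero.2 (one_ne_zero (α := k))),
        zpow_one, smul_add, smul_sub, smul_smul, hε, one_smul]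
      module))
  eq_zero g hg x := Subtype.ext (Prod.ext (A.eq_zero g hg _) (x.2.2 hg))

/-- The projection of the path object to the source. -/
def pathFst : path f f' ⟶ A :=
  ({ app := fun _ => (LinearMap.fst k _ _).comp (Submodule.subtype _)
     map_one := rfl
     map_mul := fun _ _ _ => rfl
     map_d := fun _ _ => rfl } : Hom (path f f') A)

theorem fib_pathFst : fib k W (pathFst f f') :=
  fun g hg a => ⟨⟨(a, 0), ⟨fun h => by omega, fun _ => rfl⟩⟩, rfl⟩

/-- The second component of an element of the path object. -/
def pathSnd {g : ℤ × W} (x : (path f f').X g) : B.X (g + δ) := (x : pathSubmodule f f' g).1.2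

theorem path_ext {g : ℤ × W} {x y : (path f f').X g}
    (h₁ : app (pathFst f f') g x = app (pathFst f f') g y) (h₂ : pathSnd f f' x = pathSnd f f' y) :
    x = y := Subtype.ext (Prod.ext h₁ h₂)

theorem pathSnd_mul {g h i : ℤ × W} (e : g + h = i) (x : (path f f').X g) (y : (path f f').X h) :
    pathSnd f f' ((path f f').mul e x y) =
      B.mul (by rw [← e, add_right_comm]) (pathSnd f f' x) (app f' h (app (pathFst f f') h y)) +
        (-1 : k) ^ g.1 •
          B.mul (by rw [← e, add_assoc]) (app f g (app (pathFst f f') g x)) (pathSnd f f' y) := rfl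

theorem pathSnd_d {i : ℤ × W} (x : (path f f').X (i + δ)) :
    pathSnd f f' ((path f f').d rfl x) =
      app f _ (app (pathFst f f') _ x) - app f' _ (app (pathFst f f') _ x) -
        B.d rfl (pathSnd f f' x) :=
  congrArg (· - B.d rfl (pathSnd f f' x)) (recast_rfl _)

/-- The morphism to a path object given by a morphism which equalizes `f` and `f'`. -/
def pathLift {C : GradedDGA k W} (i : C ⟶ A) (h : i ≫ f = i ≫ f') : C ⟶ path f f' :=
  let l (g : ℤ × W) : C.X g →ₗ[k] (path f f').X g :=
    ((app i g).prod 0).codRestrict (pathSubmodule f f' g) (fun x =>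
      ⟨fun _ => by
        have := congr_app h g x
        simp only [comp_app] at this
        simp [this], fun _ => rfl⟩)
  have hl (g : ℤ × W) (x : C.X g) : pathSnd f f' (l g x) = 0 := rfl
  ({ app := l
     map_one := path_ext f f' (map_one i) rfl
     map_mul := fun e x y => path_ext f f' (map_mul i e x y) (by
        rw [pathSnd_mul, hl, hl, hl]
        simp)
     map_d := fun {a b} e x => path_ext f f' (map_d i e x) (by
        subst e
        have : app f _ (app i _ x) = app f' _ (app i _ x) := congr_app h _ x
        rw [pathSnd_d, hl, hl, _root_.map_zero, sub_zero]
        exact (sub_eq_zero.2 this).symm) } : Hom C (path f f'))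

theorem exists_homotopy_of_section (s : A ⟶ path f f') (hs : s ≫ pathFst f f' = 𝟙 A)
    {h i j : ℤ × W} (e : i + δ = h) (e' : j + δ = i) (a : A.X i) (ha : A.d e' a = 0) :
    ∃ y : B.X h, B.d e y = app f i a - app f' i a := by
  subst e e'
  have h₁ : app (pathFst f f') _ (app s _ a) = a := congr_app hs _ a
  have h₂ := pathSnd_d f f' (app s _ a)
  rw [← map_d, ha, _root_.map_zero, h₁] at h₂
  exact ⟨pathSnd f f' (app s _ a), (sub_eq_zero.1 h₂.symm).symm⟩

end Homotopy

/-- A morphism `i : A ⟶ B` with the left lifting property with respect to fibrations is a weak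
equivalence: it has a retraction `r`, since all objects are fibrant, and lifting against the path
object of `𝟙 B` and `r ≫ i` gives a homotopy between them. -/
theorem weq_of_fib_llp {A B : GradedDGA k W} {i : A ⟶ B} (hi : (fib k W).llp i) : weq k W i := by
  have sq₁ : CommSq (𝟙 A) i (default : A ⟶ trivial k W) default := ⟨Subsingleton.elim _ _⟩
  have : HasLiftingProperty i (default : A ⟶ trivial k W) := hi _ fun _ _ _ => ⟨0, rfl⟩
  have hr : i ≫ sq₁.lift = 𝟙 A := sq₁.fac_left
  generalize sq₁.lift = r at hr
  have h : i ≫ 𝟙 B = i ≫ r ≫ i := by rw [← Category.assoc, hr, Category.id_comp, Category.comp_id]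
  have sq₂ : CommSq (pathLift _ _ i h) i (pathFst _ _) (𝟙 B) := ⟨rfl⟩
  have : HasLiftingProperty i (pathFst (𝟙 B) (r ≫ i)) := hi _ (fib_pathFst _ _)
  refine fun a b c e e' => ⟨fun z hz ⟨y, hy⟩ => ⟨app r _ y, ?_⟩, fun b hb => ?_⟩
  · rw [← map_d, hy, ← comp_app, hr, id_app]
  · obtain ⟨y, hy⟩ := exists_homotopy_of_section _ _ sq₂.lift sq₂.fac_right e e' b hb
    refine ⟨app r _ b, y, by rw [← map_d, hb, _root_.map_zero], ?_⟩
    rw [hy, id_app, comp_app, add_sub_cancel]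

/-! ### The model structure on graded dg-algebras -/

variable (k W) in
/-- The cofibrations: the morphisms with the left lifting property with respect to all acyclic
fibrations. -/
def cof : MorphismProperty (GradedDGA k W) := (tfib k W).llp

theorem cof_and_weq : cof k W ⊓ weq k W = (fib k W).llp := by
  refine le_antisymm (fun A B i hi => ?_)
    (fun A B i hi => ⟨fun _ _ p hp => hi p ((tfib_iff p).1 hp).2, weq_of_fib_llp hi⟩)
  obtain ⟨hi, hw⟩ := hi
  -- The retract argument, for the factorization of `i` through `acofExtι`.
  have fac : acofExtι A B ≫ acofExtDesc i (fun _ b => b.1) = i := rfl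
  have hp : tfib k W (acofExtDesc i fun _ b => b.1) :=
    (tfib_iff _).2 ⟨weq_of_precomp (weq_of_fib_llp acofExtι_llp) (by rwa [fac]),
      fib_acofExtDesc i⟩
  have := hi _ hp
  exact MorphismProperty.of_retract (RetractArrow.ofLeftLiftingProperty fac) acofExtι_llp

instance : CategoryWithFibrations (GradedDGA k W) := ⟨fib k W⟩
instance : CategoryWithCofibrations (GradedDGA k W) := ⟨cof k W⟩
instance : CategoryWithWeakEquivalences (GradedDGA k W) := ⟨weq k W⟩

theorem fibrations_eq : fibrations (GradedDGA k W) = fib k W := rfl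

theorem cofibrations_eq : cofibrations (GradedDGA k W) = cof k W := rfl

theorem trivialFibrations_eq : trivialFibrations (GradedDGA k W) = tfib k W := by
  rw [tfib_eq, inf_comm]
  rfl

theorem trivialCofibrations_eq : trivialCofibrations (GradedDGA k W) = (fib k W).llp := cof_and_weq

instance : (weakEquivalences (GradedDGA k W)).HasTwoOutOfThreeProperty :=
  inferInstanceAs (weq k W).HasTwoOutOfThreeProperty

theorem of_retract_fib {A B X Y : GradedDGA k W} {f : A ⟶ B} {p : X ⟶ Y} (h : RetractArrow f p)
    (hp : fib k W p) : fib k W f := by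
  intro g hg b
  obtain ⟨x, hx⟩ := hp g hg (app (A := B) (B := Y) h.i.right g b)
  refine ⟨app (A := X) (B := A) h.r.left g x, ?_⟩
  exact (congr_app h.r.w g x).trans
    ((congrArg (app (A := Y) (B := B) h.r.right g) hx).trans (congr_app h.retract_right g b))

theorem of_retract_tfib {A B X Y : GradedDGA k W} {f : A ⟶ B} {p : X ⟶ Y} (h : RetractArrow f p)
    (hp : tfib k W p) : tfib k W f := by
  intro a b c e e' z y hz hzy
  let il : A ⟶ X := h.i.left
  let ir : B ⟶ Y := h.i.right
  let rl : X ⟶ A := h.r.left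
  let rr : Y ⟶ B := h.r.right
  have h₁ : ∀ g (x : A.X g), app p g (app il g x) = app ir g (app f g x) :=
    fun g x => congr_app h.i.w g x
  have h₂ : ∀ g (x : X.X g), app f g (app rl g x) = app rr g (app p g x) :=
    fun g x => congr_app h.r.w g x
  have h₃ : ∀ g (x : A.X g), app rl g (app il g x) = x := fun g x => congr_app h.retract_left g x
  have h₄ : ∀ g (x : B.X g), app rr g (app ir g x) = x := fun g x => congr_app h.retract_right g x
  obtain ⟨x, hx, hx'⟩ := hp e e' (app il b z) (app ir a y)
    (by rw [← map_d, hz, _root_.map_zero]) (by rw [h₁, hzy, map_d])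
  exact ⟨app rl a x, by rw [← map_d, hx, h₃], by rw [h₂, hx', h₄]⟩

instance : MorphismProperty.IsWeakFactorizationSystem (cofibrations (GradedDGA k W))
    (trivialFibrations (GradedDGA k W)) := by
  rw [trivialFibrations_eq, cofibrations_eq]
  have : (tfib k W).IsStableUnderRetracts := ⟨of_retract_tfib⟩
  have : (cof k W).IsStableUnderRetracts := inferInstanceAs (tfib k W).llp.IsStableUnderRetracts
  have : MorphismProperty.HasFactorization (cof k W) (tfib k W) :=
    ⟨fun f => ⟨⟨_, cofExtι f, cofExtπ f, cofExt_fac f, cofExtι_llp f, tfib_cofExtπ f⟩⟩⟩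
  exact .mk' _ _ fun i p hi hp => hi p hp

instance : MorphismProperty.IsWeakFactorizationSystem (trivialCofibrations (GradedDGA k W))
    (fibrations (GradedDGA k W)) := by
  rw [trivialCofibrations_eq, fibrations_eq]
  have : (fib k W).IsStableUnderRetracts := ⟨of_retract_fib⟩
  have : MorphismProperty.HasFactorization (fib k W).llp (fib k W) :=
    ⟨fun f => ⟨⟨_, acofExtι _ _, acofExtDesc f _, rfl, acofExtι_llp, fib_acofExtDesc f⟩⟩⟩
  exact .mk' _ _ fun i p hi hp => hi p hp

instance : ModelCategory (GradedDGA k W) := ModelCategory.mk' _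

end GradedDGA

/-! ### Characters of the torus and weight spaces -/

namespace AlgTorus

variable {k : Type u} [Field k] {r : ℕ}

theorem character_one (n : Fin r → ℤ) : character n (1 : AlgTorus k r) = 1 := by
  simp [character]

theorem character_mul (n : Fin r → ℤ) (s t : AlgTorus k r) :
    character n (s * t) = character n s * character n t := by
  simp [character, mul_zpow, Finset.prod_mul_distrib]

theorem character_zero (t : AlgTorus k r) : character 0 t = 1 := by
  simp [character]

theorem character_add (m n : Fin r → ℤ) (t : AlgTorus k r) :
    character (m + n) t = character m t * character n t := by
  simp [character, zpow_add, Finset.prod_mul_distrib]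

/-- The character of a given weight as a monoid homomorphism. -/
def characterHom (n : Fin r → ℤ) : AlgTorus k r →* k where
  toFun := character n
  map_one' := character_one n
  map_mul' := character_mul n

variable {M : Type u} [AddCommGroup M] [Module k M] (σ : Representation k (AlgTorus k r) M)

/-- The space of vectors of weight `w`. -/
def weightSpace (w : Fin r → ℤ) : Submodule k M where
  carrier := {a | ∀ t, σ t a = character w t • a}
  add_mem' ha hb t := by rw [map_add, ha t, hb t, smul_add]
  zero_mem' t := by simp
  smul_mem' c a ha t := by rw [map_smul, ha t, smul_comm]

variable [CharZero k]

theorem characterHom_injective : Function.Injective (characterHom (k := k) (r := r)) := by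
  intro m n h
  funext i
  -- Evaluate at the element with `i`-th coordinate `2`: its powers are distinct in `ℚ ⊆ k`.
  have h2 : (2 : k) ≠ 0 := two_ne_zero
  have hm (l : Fin r → ℤ) : characterHom l (Pi.mulSingle i (Units.mk0 2 h2)) = (2 : k) ^ l i := by
    simp only [characterHom, MonoidHom.coe_mk, OneHom.coe_mk, character]
    rw [Finset.prod_eq_single i (fun j _ hj => by rw [Pi.mulSingle_eq_of_ne hj, one_zpow])
      (by simp)]
    simp
  have h' : (2 : k) ^ m i = (2 : k) ^ n i := by rw [← hm, ← hm, h]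
  have h'' : (((2 : ℚ) ^ m i : ℚ) : k) = ((2 : ℚ) ^ n i : ℚ) := by push_cast; exact h'
  exact zpow_right_injective₀ (by norm_num) (by norm_num) (Rat.cast_injective h'')

/-- Characters are linearly independent, also with coefficients in a vector space. -/
theorem eq_zero_of_sum_character_smul {V : Type*} [AddCommGroup V] [Module k V]
    (s : Finset (Fin r → ℤ)) (v : (Fin r → ℤ) → V)
    (h : ∀ t : AlgTorus k r, ∑ n ∈ s, character n t • v n = 0) : ∀ n ∈ s, v n = 0 := by
  intro n hn
  rw [← Module.forall_dual_apply_eq_zero_iff k]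
  intro l
  have hli := (linearIndependent_monoidHom (AlgTorus k r) k).comp _
    (characterHom_injective (k := k) (r := r))
  refine (linearIndependent_iff'.1 hli) s (fun n => l (v n)) (funext fun t => ?_) n hn
  have := congrArg l (h t)
  simp only [map_sum, map_smul, map_zero, smul_eq_mul] at this
  simpa [characterHom, mul_comm] using this

theorem iSupIndep_weightSpace : iSupIndep (weightSpace σ) := by
  rw [iSupIndep_iff_finsetSum_eq_zero_imp_eq_zero]
  intro s v hv h n hn
  refine eq_zero_of_sum_character_smul (k := k) s v (fun t => ?_) n hn
  rw [← map_zero (σ t), ← h, map_sum]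
  exact Finset.sum_congr rfl fun n hn => (hv n hn t).symm

/-- A vector in a finite dimensional algebraic subrepresentation is a sum of weight vectors. -/
theorem mem_iSup_weightSpace {V : Subrepresentation σ} [FiniteDimensional k V.toSubmodule]
    (hV : IsAlgebraic V.toRepresentation) {a : M} (ha : a ∈ V) : a ∈ ⨆ w, weightSpace σ w := by
  classical
  let b := Module.finBasis k V.toSubmodule
  have hP : ∀ i, IsRegular fun t => b.coord i (V.toRepresentation t ⟨a, ha⟩) :=
    fun i => hV (b.coord i) ⟨a, ha⟩
  choose P hP using hP
  let s := Finset.univ.biUnion fun i => (P i).support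
  -- The component of weight `n` has the coordinates `P i n`.
  let v : (Fin r → ℤ) → M := fun n => ∑ i, P i n • (b i : M)
  have hσ : ∀ t, σ t a = ∑ n ∈ s, character n t • v n := by
    intro t
    have h₁ : σ t a = ((V.toRepresentation t ⟨a, ha⟩ : V.toSubmodule) : M) := rfl
    rw [h₁, ← b.sum_repr (V.toRepresentation t ⟨a, ha⟩)]
    simp only [v, Finset.smul_sum, smul_smul]
    rw [Finset.sum_comm, AddSubmonoidClass.coe_finsetSum]
    refine Finset.sum_congr rfl fun i _ => ?_
    have h₂ : b.repr (V.toRepresentation t ⟨a, ha⟩) i = (P i).sum fun n c => c * character n t :=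
      hP i t
    rw [h₂, Submodule.coe_smul, Finsupp.sum_of_support_subset (P i) (s := s)
      (Finset.subset_biUnion_of_mem (fun i => (P i).support) (Finset.mem_univ i)) _ (by simp),
      Finset.sum_smul]
    simp only [mul_comm]
  have hv : ∀ n ∈ s, v n ∈ weightSpace σ n := by
    intro n hn t
    refine sub_eq_zero.1 (eq_zero_of_sum_character_smul (k := k) s
      (fun n => σ t (v n) - character n t • v n) (fun u => ?_) n hn)
    have h₁ : σ t (σ u a) = σ (u * t) a := by rw [mul_comm, map_mul]; rfl
    rw [hσ u, hσ (u * t), map_sum, ← sub_eq_zero, ← Finset.sum_sub_distrib] at h₁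
    rw [← h₁]
    refine Finset.sum_congr rfl fun m _ => ?_
    rw [smul_sub, smul_smul, ← character_mul, map_smul]
  have h1 : a = ∑ n ∈ s, v n := by
    have := hσ 1
    simpa only [map_one, character_one, one_smul, Module.End.one_apply] using this
  rw [h1]
  exact Submodule.sum_mem _ fun n hn => Submodule.mem_iSup_of_mem n (hv n hn)

end AlgTorus

namespace DGAlgPlus

variable {k : Type u} [Field k] {W : Type} [AddCommGroup W]

/-! ### Graded dg-algebras inside dg-algebras -/

/-- The components of a dg-algebra, extended by zero to negative degrees. -/
def intGr (B : DGAlgPlus k) : ℤ → Submodule k B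
  | .ofNat n => B.gr n
  | .negSucc _ => ⊥

variable (B : DGAlgPlus k)

theorem intGr_of_neg {n : ℤ} (hn : n < 0) : intGr B n = ⊥ := by
  obtain n | n := n
  · exact (not_le.2 hn (Int.natCast_nonneg n)).elim
  · rfl

theorem one_mem_intGr : (1 : B) ∈ intGr B 0 := SetLike.one_mem_graded B.gr

theorem mul_mem_intGr {m n l : ℤ} (e : m + n = l) {a b : B} (ha : a ∈ intGr B m)
    (hb : b ∈ intGr B n) : a * b ∈ intGr B l := by
  subst e
  obtain m | m := m
  swap
  · rw [(Submodule.mem_bot k).1 ha, zero_mul]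
    exact zero_mem _
  obtain n | n := n
  swap
  · rw [(Submodule.mem_bot k).1 hb, mul_zero]
    exact zero_mem _
  exact SetLike.mul_mem_graded (A := B.gr) ha hb

theorem d_mem_intGr {m n : ℤ} (e : n + 1 = m) {a : B} (ha : a ∈ intGr B m) : B.d a ∈ intGr B n := by
  subst e
  obtain n | n := n
  · exact B.d_mem n a ha
  · obtain _ | n := n
    · rw [B.d_zero a ha]
      exact zero_mem _
    · rw [intGr_of_neg B (by omega)] at ha
      rw [(Submodule.mem_bot k).1 ha, map_zero]
      exact zero_mem _

theorem leibniz_intGr {m : ℤ} {a : B} (ha : a ∈ intGr B m) (b : B) :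
    B.d (a * b) = B.d a * b + (-1 : k) ^ m • (a * B.d b) := by
  obtain m | m := m
  · rw [B.leibniz m a b ha, Int.ofNat_eq_natCast, zpow_natCast, Algebra.smul_def, map_pow, map_neg,
      map_one]
  · rw [(Submodule.mem_bot k).1 ha]
    simp

theorem _root_.DGAlgPlus.Hom.map_mem_intGr {B C : DGAlgPlus k} (f : B ⟶ C) {n : ℤ} {a : B}
    (ha : a ∈ intGr B n) : f.toAlgHom a ∈ intGr C n := by
  obtain n | n := n
  · exact f.map_mem n a ha
  · rw [(Submodule.mem_bot k).1 ha, map_zero]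
    exact zero_mem _

/-- A family of subspaces of a dg-algebra which is compatible with its structure, so that it is
a graded dg-algebra. -/
structure IsGradedFamily (S : ℤ × W → Submodule k B) : Prop where
  le : ∀ g, S g ≤ intGr B g.1
  one_mem : 1 ∈ S 0
  mul_mem : ∀ {g h} {a b : B}, a ∈ S g → b ∈ S h → a * b ∈ S (g + h)
  d_mem : ∀ {g} {a : B}, a ∈ S (g + shiftDeg W) → B.d a ∈ S g

variable {B} in
/-- The graded dg-algebra of a compatible family of subspaces. -/
def IsGradedFamily.toGradedDGA {S : ℤ × W → Submodule k B} (hS : IsGradedFamily B S) :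
    GradedDGA k W where
  X g := S g
  one := ⟨1, hS.one_mem⟩
  mul e := LinearMap.mk₂ k (fun a b => ⟨(a : B) * b, e ▸ hS.mul_mem a.2 b.2⟩)
    (fun _ _ _ => Subtype.ext (add_mul _ _ _)) (fun _ _ _ => Subtype.ext (smul_mul_assoc _ _ _))
    (fun _ _ _ => Subtype.ext (mul_add _ _ _)) (fun _ _ _ => Subtype.ext (mul_smul_comm _ _ _))
  d {i j} e := B.d.restrict fun a ha => hS.d_mem (g := j) (by rwa [e])
  one_mul _ _ := Subtype.ext (one_mul _)
  mul_one _ _ := Subtype.ext (mul_one _)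
  mul_assoc _ _ _ _ _ _ _ := Subtype.ext (mul_assoc _ _ _)
  d_d _ _ _ := Subtype.ext (B.d_d _)
  leibniz _ _ _ _ _ _ x y := Subtype.ext (leibniz_intGr B (hS.le _ x.2) _)
  eq_zero g hg x := by
    have := hS.le g x.2
    rw [intGr_of_neg B hg] at this
    exact Subtype.ext ((Submodule.mem_bot k).1 this)

variable {B} in
/-- The morphism of graded dg-algebras which is the restriction of a morphism of dg-algebras. -/
def IsGradedFamily.map {C : DGAlgPlus k} {S : ℤ × W → Submodule k B} {S' : ℤ × W → Submodule k C}
    (hS : IsGradedFamily B S) (hS' : IsGradedFamily C S') (f : B ⟶ C)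
    (hf : ∀ g, ∀ a ∈ S g, f.toAlgHom a ∈ S' g) : hS.toGradedDGA ⟶ hS'.toGradedDGA :=
  ({ app := fun g => f.toAlgHom.toLinearMap.restrict (hf g)
     map_one := Subtype.ext (map_one f.toAlgHom)
     map_mul := fun _ _ _ => Subtype.ext (map_mul f.toAlgHom _ _)
     map_d := fun _ _ => Subtype.ext (f.map_d _) } :
    GradedDGA.Hom hS.toGradedDGA hS'.toGradedDGA)

theorem isGradedFamily_intGr : IsGradedFamily (W := W) B fun g => intGr B g.1 where
  le _ := le_rfl
  one_mem := one_mem_intGr B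
  mul_mem := mul_mem_intGr B rfl
  d_mem := d_mem_intGr B rfl

variable (W) in
/-- The graded dg-algebra with a copy of `B` in each weight. Morphisms to it from the weight spaces
of a dg-algebra `A` with a rational action correspond to morphisms `A ⟶ B`. -/
def cofree : GradedDGA k W := (isGradedFamily_intGr (W := W) B).toGradedDGA

variable (W) in
/-- The morphism between algebras `cofree` induced by a morphism of dg-algebras. -/
def cofreeMap {B C : DGAlgPlus k} (f : B ⟶ C) : cofree W B ⟶ cofree W C :=
  (isGradedFamily_intGr B).map (isGradedFamily_intGr C) f fun _ _ => f.map_mem_intGr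

/-! ### The weight decomposition of a dg-algebra with a rational action -/

variable {r : ℕ}

/-- The component of a given degree and weight of a dg-algebra with an action of the torus. -/
def comp (A : Action (DGAlgPlus k) (AlgTorus k r)) (g : ℤ × (Fin r → ℤ)) : Submodule k A.V :=
  intGr A.V g.1 ⊓ AlgTorus.weightSpace (rep A) g.2

theorem rep_one (A : Action (DGAlgPlus k) (AlgTorus k r)) (t : AlgTorus k r) : rep A t 1 = 1 :=
  map_one (A.ρ t : A.V ⟶ A.V).toAlgHom

theorem rep_mul (A : Action (DGAlgPlus k) (AlgTorus k r)) (t : AlgTorus k r) (a b : A.V) :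
    rep A t (a * b) = rep A t a * rep A t b :=
  map_mul (A.ρ t : A.V ⟶ A.V).toAlgHom a b

theorem rep_d (A : Action (DGAlgPlus k) (AlgTorus k r)) (t : AlgTorus k r) (a : A.V) :
    rep A t (A.V.d a) = A.V.d (rep A t a) :=
  (A.ρ t : A.V ⟶ A.V).map_d a

theorem rep_mem (A : Action (DGAlgPlus k) (AlgTorus k r)) (t : AlgTorus k r) {n : ℕ} {a : A.V}
    (ha : a ∈ A.V.gr n) : rep A t a ∈ A.V.gr n :=
  (A.ρ t : A.V ⟶ A.V).map_mem n a ha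

theorem isGradedFamily_comp (A : Action (DGAlgPlus k) (AlgTorus k r)) :
    IsGradedFamily A.V (comp A) where
  le _ := inf_le_left
  one_mem := ⟨one_mem_intGr A.V, fun t => by
    rw [rep_one, Prod.snd_zero, AlgTorus.character_zero, one_smul]⟩
  mul_mem ha hb := ⟨mul_mem_intGr A.V rfl ha.1 hb.1, fun t => by
    rw [rep_mul, ha.2 t, hb.2 t, Prod.snd_add, AlgTorus.character_add, smul_mul_smul_comm]⟩
  d_mem {g a} ha := ⟨d_mem_intGr A.V rfl ha.1, fun t => by
    rw [rep_d, ha.2 t, map_smul]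
    simp [shiftDeg]⟩

/-- The projection to a homogeneous component commutes with the action. -/
theorem decompose_rep (A : Action (DGAlgPlus k) (AlgTorus k r)) (t : AlgTorus k r) (a : A.V)
    (n : ℕ) : (DirectSum.decompose A.V.gr (rep A t a) n : A.V) =
      rep A t (DirectSum.decompose A.V.gr a n) := by
  classical
  induction a using DirectSum.Decomposition.inductionOn A.V.gr with
  | zero => simp
  | @homogeneous i a =>
    by_cases h : i = n
    · subst h
      rw [DirectSum.decompose_of_mem_same _ (rep_mem A t a.2),
        DirectSum.decompose_of_mem_same _ a.2]
    · rw [DirectSum.decompose_of_mem_ne _ (rep_mem A t a.2) h,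
        DirectSum.decompose_of_mem_ne _ a.2 h, map_zero]
  | add a b ha hb =>
    simp only [map_add, DirectSum.decompose_add, DirectSum.add_apply, Submodule.coe_add, ha, hb]

theorem iSupIndep_intGr (B : DGAlgPlus k) : iSupIndep (intGr B) := by
  have h := (DirectSum.Decomposition.isInternal B.gr).submodule_iSupIndep
  rw [iSupIndep_def] at h ⊢
  intro n
  obtain n | n := n
  swap
  · exact disjoint_bot_left
  refine (h n).mono_right (iSup₂_le fun m hm => ?_)
  obtain m | m := m
  · exact le_iSup₂_of_le m (fun h => hm (by rw [h])) le_rfl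
  · exact bot_le

section Rational

variable [CharZero k] {A : Action (DGAlgPlus k) (AlgTorus k r)}

theorem gr_le_iSup_comp (hA : IsRational k r A) (n : ℕ) :
    A.V.gr n ≤ ⨆ w, comp A (n, w) := by
  intro a ha
  have h : a ∈ ⨆ w, AlgTorus.weightSpace (rep A) w := by
    obtain ⟨V, haV, hfin, hV⟩ := hA a
    exact AlgTorus.mem_iSup_weightSpace _ hV haV
  -- Project a decomposition of `a` into weight vectors to the component of degree `n`.
  have key : ∀ b ∈ ⨆ w, AlgTorus.weightSpace (rep A) w,
      (DirectSum.decompose A.V.gr b n : A.V) ∈ ⨆ w, comp A (n, w) := by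
    intro b hb
    induction hb using Submodule.iSup_induction' with
    | mem w b hb =>
      refine Submodule.mem_iSup_of_mem w ⟨(DirectSum.decompose A.V.gr b n).2, fun t => ?_⟩
      rw [← decompose_rep, hb t, DirectSum.decompose_smul]
      rfl
    | zero => simp
    | add b c _ _ hb hc =>
      rw [DirectSum.decompose_add, DirectSum.add_apply, Submodule.coe_add]
      exact add_mem hb hc
  rw [← DirectSum.decompose_of_mem_same _ ha]
  exact key a h

theorem iSup_comp (hA : IsRational k r A) : ⨆ g, comp A g = ⊤ := by
  rw [eq_top_iff, ← (DirectSum.Decomposition.isInternal A.V.gr).submodule_iSup_eq_top]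
  exact iSup_le fun n => (gr_le_iSup_comp hA n).trans
    (iSup_le fun w => le_iSup (comp A) ((n : ℤ), w))

theorem iSupIndep_comp (A : Action (DGAlgPlus k) (AlgTorus k r)) : iSupIndep (comp A) := by
  classical
  have h₁ := iSupIndep_intGr A.V
  have h₂ := AlgTorus.iSupIndep_weightSpace (rep A)
  rw [iSupIndep_iff_finsetSum_eq_zero_imp_eq_zero] at h₁ h₂ ⊢
  intro s v hv h g hg
  have key := h₁ (s.image Prod.fst) (fun n => ∑ g ∈ s with g.1 = n, v g)
    (fun n _ => Submodule.sum_mem _ fun i hi => by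
      have hi' := Finset.mem_filter.1 hi
      exact hi'.2 ▸ (hv i hi'.1).1)
    (by rw [Finset.sum_fiberwise_of_maps_to (fun g hg => Finset.mem_image_of_mem _ hg), h])
    g.1 (Finset.mem_image_of_mem _ hg)
  have hfst : ∀ i ∈ s.filter (fun i => i.1 = g.1), (g.1, i.2) = i := fun i hi =>
    Prod.ext (Finset.mem_filter.1 hi).2.symm rfl
  refine h₂ ((s.filter fun i => i.1 = g.1).image Prod.snd) (fun w => v (g.1, w)) (fun w hw => ?_) ?_
    g.2 (Finset.mem_image_of_mem _ (Finset.mem_filter.2 ⟨hg, rfl⟩))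
  · obtain ⟨i, hi, rfl⟩ := Finset.mem_image.1 hw
    rw [hfst i hi]
    exact (hv i (Finset.mem_filter.1 hi).1).2
  · rw [Finset.sum_image fun i hi j hj hij => by rw [← hfst i hi, ← hfst j hj, hij]]
    exact (Finset.sum_congr rfl fun i hi => by rw [hfst i hi]).trans key

theorem isInternal_comp (hA : IsRational k r A) : DirectSum.IsInternal (comp A) :=
  (DirectSum.isInternal_submodule_iff_iSupIndep_and_iSup_eq_top _).2
    ⟨iSupIndep_comp A, iSup_comp hA⟩

/-- The decomposition of the total space into the components of all degrees and weights. -/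
def compEquiv (hA : IsRational k r A) : (DirectSum _ fun g => comp A g) ≃ₗ[k] A.V :=
  LinearEquiv.ofBijective (DirectSum.coeLinearMap (comp A)) (isInternal_comp hA)

/-- The linear map on the total space with given restrictions to all components. -/
def glue (hA : IsRational k r A) {M : Type u} [AddCommGroup M] [Module k M]
    (f : ∀ g, comp A g →ₗ[k] M) : A.V →ₗ[k] M :=
  (DirectSum.toModule k _ M f).comp (compEquiv hA).symm.toLinearMap

theorem glue_coe (hA : IsRational k r A) {M : Type u} [AddCommGroup M] [Module k M]
    (f : ∀ g, comp A g →ₗ[k] M) (g : ℤ × (Fin r → ℤ)) (a : comp A g) : glue hA f a = f g a := by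
  have h : (compEquiv hA).symm (a : A.V) = DirectSum.lof k _ _ g a := by
    rw [LinearEquiv.symm_apply_eq]
    exact (DirectSum.coeLinearMap_lof (comp A) g a).symm
  simp only [glue, LinearMap.comp_apply, LinearEquiv.coe_coe]
  rw [h, DirectSum.toModule_lof]

/-- Induction on sums of homogeneous weight vectors. -/
theorem comp_induction (hA : IsRational k r A) {p : A.V → Prop} (a : A.V)
    (hmem : ∀ g, ∀ b ∈ comp A g, p b) (hzero : p 0) (hadd : ∀ b c, p b → p c → p (b + c)) : p a :=
  Submodule.iSup_induction (comp A) (motive := p) (by rw [iSup_comp hA]; trivial) hmem hzero hadd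

end Rational

end DGAlgPlus

/-! ### Quasi-isomorphisms in terms of elements -/

namespace HomologicalComplex

variable {k : Type u} [Field k] {ι : Type*} {c : ComplexShape ι}
  {K L : HomologicalComplex (ModuleCat.{u} k) c} (φ : K ⟶ L)

theorem mono_homologyMap_iff_elements (i j l : ι) (hi : c.prev j = i) (hl : c.next j = l) :
    Mono (homologyMap φ j) ↔ ∀ (x : K.X j), K.d j l x = 0 → ∀ y : L.X i, φ.f j x = L.d i j y →
      ∃ x' : K.X i, K.d i j x' = x := by
  rw [mono_homologyMap_iff_up_to_refinements φ i j l hi hl]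
  constructor
  · intro h x hx y hy
    obtain ⟨A', π, hπ, x₁, hx₁⟩ := h (A := ModuleCat.of k k)
      (ModuleCat.ofHom (LinearMap.toSpanSingleton k _ x)) (by ext; simpa using hx)
      (ModuleCat.ofHom (LinearMap.toSpanSingleton k _ y)) (by ext; simpa using hy)
    obtain ⟨a, ha⟩ := (ModuleCat.epi_iff_surjective π).1 hπ 1
    refine ⟨x₁ a, ?_⟩
    have := congrArg (fun f => f.hom a) hx₁
    simpa [ha] using this.symm
  · intro h A x₂ hx₂ y₁ hy
    let S := LinearMap.eqLocus (x₂.hom.comp (LinearMap.fst k A (K.X i)))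
      ((K.d i j).hom.comp (LinearMap.snd k A (K.X i)))
    refine ⟨ModuleCat.of k S, ModuleCat.ofHom ((LinearMap.fst k A (K.X i)).comp S.subtype),
      (ModuleCat.epi_iff_surjective _).2 fun a => ?_,
      ModuleCat.ofHom ((LinearMap.snd k A (K.X i)).comp S.subtype), ?_⟩
    · obtain ⟨x', hx'⟩ := h (x₂ a) (congrArg (fun f => f.hom a) hx₂) (y₁ a)
        (congrArg (fun f => f.hom a) hy)
      exact ⟨⟨(a, x'), hx'.symm⟩, rfl⟩
    · ext s
      exact s.2

theorem epi_homologyMap_iff_elements (i j l : ι) (hi : c.prev j = i) (hl : c.next j = l) :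
    Epi (homologyMap φ j) ↔ ∀ (y : L.X j), L.d j l y = 0 →
      ∃ (x : K.X j) (y' : L.X i), K.d j l x = 0 ∧ y = φ.f j x + L.d i j y' := by
  rw [epi_homologyMap_iff_up_to_refinements φ i j l hi hl]
  constructor
  · intro h y hy
    obtain ⟨A', π, hπ, x₂, hx₂, y₁, hy₁⟩ := h (A := ModuleCat.of k k)
      (ModuleCat.ofHom (LinearMap.toSpanSingleton k _ y)) (by ext; simpa using hy)
    obtain ⟨a, ha⟩ := (ModuleCat.epi_iff_surjective π).1 hπ 1
    refine ⟨x₂ a, y₁ a, congrArg (fun f => f.hom a) hx₂, ?_⟩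
    have := congrArg (fun f => f.hom a) hy₁
    simpa [ha] using this
  · intro h A y₂ hy₂
    let p := LinearMap.fst k A (K.X j × L.X i)
    let q := (LinearMap.fst k (K.X j) (L.X i)).comp (LinearMap.snd k A (K.X j × L.X i))
    let q' := (LinearMap.snd k (K.X j) (L.X i)).comp (LinearMap.snd k A (K.X j × L.X i))
    let S := LinearMap.eqLocus (y₂.hom.comp p) ((φ.f j).hom.comp q + (L.d i j).hom.comp q') ⊓
      LinearMap.ker ((K.d j l).hom.comp q)
    refine ⟨ModuleCat.of k S, ModuleCat.ofHom (p.comp S.subtype),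
      (ModuleCat.epi_iff_surjective _).2 fun a => ?_, ModuleCat.ofHom (q.comp S.subtype), ?_,
      ModuleCat.ofHom (q'.comp S.subtype), ?_⟩
    · obtain ⟨x, y', hx, hy⟩ := h (y₂ a) (congrArg (fun f => f.hom a) hy₂)
      exact ⟨⟨(a, x, y'), hy, hx⟩, rfl⟩
    · ext s
      exact s.2.2
    · ext s
      exact s.2.1

end HomologicalComplex

namespace DGAlgPlus

variable {k : Type u} [Field k]

theorem weq_iff {A B : DGAlgPlus k} (f : A ⟶ B) : weq k f ↔ ∀ n : ℕ,
    (∀ a ∈ A.gr n, A.d a = 0 → (∃ b ∈ B.gr (n + 1), B.d b = f.toAlgHom a) →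
      ∃ x ∈ A.gr (n + 1), A.d x = a) ∧
    ∀ b ∈ B.gr n, B.d b = 0 → ∃ a ∈ A.gr n, ∃ y ∈ B.gr (n + 1),
      A.d a = 0 ∧ b = f.toAlgHom a + B.d y := by
  have h₁ : weq k f ↔ QuasiIso ((chainFunctor k).map f) := Iff.rfl
  rw [h₁, quasiIso_iff]
  refine forall_congr' fun n => ?_
  rw [quasiIsoAt_iff_isIso_homologyMap, isIso_iff_mono_and_epi,
    HomologicalComplex.mono_homologyMap_iff_elements _ (n + 1) n _ (ChainComplex.prev ℕ n) rfl,
    HomologicalComplex.epi_homologyMap_iff_elements _ (n + 1) n _ (ChainComplex.prev ℕ n) rfl]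
  have hd (A : DGAlgPlus k) (a : A.gr n) :
      A.toChainComplex.d n ((ComplexShape.down ℕ).next n) a = 0 ↔ A.d a = 0 := by
    obtain _ | n := n
    · rw [A.toChainComplex.shape _ _ (by simp)]
      exact iff_of_true rfl (A.d_zero a a.2)
    · rw [ChainComplex.next_nat_succ, toChainComplex_d]
      exact Subtype.ext_iff
  have hd' (A : DGAlgPlus k) (a : A.gr (n + 1)) (b : A.gr n) :
      A.toChainComplex.d (n + 1) n a = b ↔ A.d a = b := by
    rw [toChainComplex_d]
    exact Subtype.ext_iff
  have hdv (A : DGAlgPlus k) (a : A.gr (n + 1)) :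
      Subtype.val (p := (· ∈ A.gr n)) (A.toChainComplex.d (n + 1) n a) = A.d a :=
    ((hd' A a _).1 rfl).symm
  refine and_congr ⟨fun h a ha hda ⟨b, hb, hab⟩ => ?_, fun h a hda b hab => ?_⟩
    ⟨fun h b hb hdb => ?_, fun h b hdb => ?_⟩
  · obtain ⟨x, hx⟩ := h ⟨a, ha⟩ ((hd A _).2 hda) ⟨b, hb⟩
      (((hd' B ⟨b, hb⟩ ⟨f.toAlgHom a, f.map_mem n a ha⟩).2 hab).symm)
    exact ⟨(x : A.gr (n + 1)).1, (x : A.gr (n + 1)).2, (hd' A x ⟨a, ha⟩).1 hx⟩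
  · obtain ⟨x, hx, hx'⟩ := h a.1 a.2 ((hd A a).1 hda)
      ⟨b.1, b.2, (hd' B b ⟨f.toAlgHom a.1, f.map_mem n a.1 a.2⟩).1 hab.symm⟩
    exact ⟨⟨x, hx⟩, (hd' A _ a).2 hx'⟩
  · obtain ⟨x, y, hx, hy⟩ := h ⟨b, hb⟩ ((hd B _).2 hdb)
    exact ⟨(x : A.gr n).1, (x : A.gr n).2, (y : B.gr (n + 1)).1, (y : B.gr (n + 1)).2,
      (hd A x).1 hx, (congrArg Subtype.val hy).trans
        (congrArg (f.toAlgHom (x : A.gr n).1 + ·) (hdv B y))⟩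
  · obtain ⟨x, hx, y, hy, hdx, hbxy⟩ := h b.1 b.2 ((hd B _).1 hdb)
    exact ⟨⟨x, hx⟩, ⟨y, hy⟩, (hd A ⟨x, hx⟩).2 hdx, Subtype.ext (hbxy.trans
      (congrArg (f.toAlgHom x + ·) (hdv B ⟨y, hy⟩).symm))⟩

/-! ### The functor to graded dg-algebras -/

variable {r : ℕ}

theorem hom_rep {A B : Action (DGAlgPlus k) (AlgTorus k r)} (f : A ⟶ B) (t : AlgTorus k r)
    (a : A.V) : f.hom.toAlgHom (rep A t a) = rep B t (f.hom.toAlgHom a) :=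
  congrArg (fun φ : Hom A.V B.V => φ.toAlgHom a) (f.comm t)

theorem map_mem_comp {A B : Action (DGAlgPlus k) (AlgTorus k r)} (f : A ⟶ B)
    {g : ℤ × (Fin r → ℤ)} {a : A.V} (ha : a ∈ comp A g) : f.hom.toAlgHom a ∈ comp B g :=
  ⟨f.hom.map_mem_intGr ha.1, fun t => by rw [← hom_rep, ha.2 t, map_smul]⟩

variable (k r) in
/-- The functor which sends a dg-algebra with a rational action of the torus to the family of its
weight spaces. -/
def components : Equivariant k r ⥤ GradedDGA k (Fin r → ℤ) where
  obj A := (isGradedFamily_comp A.obj).toGradedDGA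
  map {A B} f := (isGradedFamily_comp A.obj).map (isGradedFamily_comp B.obj) f.hom.hom
    fun _ _ => map_mem_comp f.hom

variable {A B : Equivariant k r}

/-- A homogeneous vector of given weight, as an element of the graded dg-algebra of weight
spaces. -/
def toComp (A : Equivariant k r) {g : ℤ × (Fin r → ℤ)} (a : A.obj.V) (ha : a ∈ comp A.obj g) :
    ((components k r).obj A).X g := ⟨a, ha⟩

/-- The element of the total space which underlies an element of a weight space. -/
def ofComp {g : ℤ × (Fin r → ℤ)} (a : ((components k r).obj A).X g) : A.obj.V :=
  (a : comp A.obj g).1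

theorem ofComp_mem {g : ℤ × (Fin r → ℤ)} (a : ((components k r).obj A).X g) :
    ofComp a ∈ comp A.obj g := (a : comp A.obj g).2

/-- The element of `B` given by an element of `cofree B`. -/
def ofCofree {W : Type} [AddCommGroup W] {B : DGAlgPlus k} {g : ℤ × W} (b : (cofree W B).X g) : B :=
  (b : intGr B g.1).1

theorem hom_ext_linear [CharZero k] (A : Equivariant k r) {M : Type u} [AddCommGroup M] [Module k M]
    {f f' : A.obj.V →ₗ[k] M} (h : ∀ g, ∀ a ∈ comp A.obj g, f a = f' a) : f = f' :=
  LinearMap.ext fun a => comp_induction A.property a h (by simp)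
    fun b c hb hc => by rw [map_add, map_add, hb, hc]

section Descend

variable [CharZero k] {B : DGAlgPlus k} (φ : (components k r).obj A ⟶ cofree (Fin r → ℤ) B)

/-- The linear map underlying `descend`. -/
def descendLinear : A.obj.V →ₗ[k] B :=
  glue A.property fun g => (intGr B g.1).subtype.comp (GradedDGA.app φ g)

theorem descendLinear_apply {g : ℤ × (Fin r → ℤ)} {a : A.obj.V} (ha : a ∈ comp A.obj g) :
    descendLinear φ a = ofCofree (GradedDGA.app φ g (toComp A a ha)) :=
  glue_coe A.property _ g ⟨a, ha⟩

theorem descendLinear_mul (a b : A.obj.V) :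
    descendLinear φ (a * b) = descendLinear φ a * descendLinear φ b := by
  refine comp_induction A.property
    (p := fun a => descendLinear φ (a * b) = descendLinear φ a * descendLinear φ b) a
    (fun g a ha => ?_) (by simp) fun a a' h h' => by rw [add_mul, map_add, map_add, add_mul, h, h']
  refine comp_induction A.property
    (p := fun b => descendLinear φ (a * b) = descendLinear φ a * descendLinear φ b) b
    (fun g' b hb => ?_) (by simp) fun b b' h h' => by rw [mul_add, map_add, map_add, mul_add, h, h']
  rw [descendLinear_apply φ ha, descendLinear_apply φ hb,
    descendLinear_apply φ ((isGradedFamily_comp A.obj).mul_mem ha hb)]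
  exact congrArg Subtype.val (GradedDGA.map_mul φ rfl (toComp A a ha) (toComp A b hb))

theorem descendLinear_one : descendLinear φ 1 = 1 := by
  rw [descendLinear_apply φ (isGradedFamily_comp A.obj).one_mem]
  exact congrArg Subtype.val (GradedDGA.map_one φ)

theorem descendLinear_d (a : A.obj.V) :
    descendLinear φ (A.obj.V.d a) = B.d (descendLinear φ a) := by
  refine comp_induction A.property
    (p := fun a => descendLinear φ (A.obj.V.d a) = B.d (descendLinear φ a)) a
    (fun g a ha => ?_) (by simp) fun a a' h h' => by rw [map_add, map_add, map_add, map_add, h, h']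
  have ha' : a ∈ comp A.obj (g - δ + δ) := by rwa [sub_add_cancel]
  rw [descendLinear_apply φ ha',
    descendLinear_apply φ ((isGradedFamily_comp A.obj).d_mem ha')]
  exact congrArg Subtype.val (GradedDGA.map_d φ rfl (toComp A a ha'))

theorem descendLinear_mem (n : ℕ) (a : A.obj.V) (ha : a ∈ A.obj.V.gr n) :
    descendLinear φ a ∈ B.gr n := by
  refine Submodule.iSup_induction _ (motive := fun a => descendLinear φ a ∈ B.gr n)
    (gr_le_iSup_comp A.property n ha) (fun w a ha => ?_) (by simp) fun a b ha hb => by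
      rw [map_add]; exact add_mem ha hb
  rw [descendLinear_apply φ ha]
  exact (GradedDGA.app φ _ (toComp A a ha) : intGr B n).2

/-- The morphism of dg-algebras from the total space given by a morphism from the components.
This is one direction of the adjunction between forgetting the action and `cofree`. -/
def descend : A.obj.V ⟶ B :=
  ({ toAlgHom := AlgHom.ofLinearMap (descendLinear φ) (descendLinear_one φ) (descendLinear_mul φ)
     map_mem := descendLinear_mem φ
     map_d := descendLinear_d φ } : Hom A.obj.V B)

theorem descend_apply {g : ℤ × (Fin r → ℤ)} {a : A.obj.V} (ha : a ∈ comp A.obj g) :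
    (descend φ).toAlgHom a = ofCofree (GradedDGA.app φ g (toComp A a ha)) :=
  descendLinear_apply φ ha

theorem dga_hom_ext {f f' : A.obj.V ⟶ B}
    (h : ∀ g, ∀ a ∈ comp A.obj g, f.toAlgHom a = f'.toAlgHom a) : f = f' :=
  Hom.ext (AlgHom.toLinearMap_injective (hom_ext_linear A h))

end Descend

/-- The morphism to `cofree B` given by a morphism to `B` from the total space. -/
def ascend {B : DGAlgPlus k} (f : A.obj.V ⟶ B) :
    (components k r).obj A ⟶ cofree (Fin r → ℤ) B :=
  (isGradedFamily_comp A.obj).map (isGradedFamily_intGr B) f fun _ _ ha => f.map_mem_intGr ha.1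

variable [CharZero k]

instance : (components k r).Faithful where
  map_injective {A B f f'} h := by
    refine ObjectProperty.hom_ext _ (Action.hom_ext _ _ (dga_hom_ext fun g a ha => ?_))
    exact congrArg ofComp (GradedDGA.congr_app h g (toComp A a ha))

instance : (components k r).Full where
  map_surjective {A B} φ := by
    let f := descend (φ ≫ ascend (𝟙 B.obj.V))
    have hf : ∀ g, ∀ a (ha : a ∈ comp A.obj g),
        f.toAlgHom a = ofComp (GradedDGA.app φ g (toComp A a ha)) := fun g a ha =>
      descend_apply _ ha
    have hf' : ∀ g, ∀ a ∈ comp A.obj g, f.toAlgHom a ∈ comp B.obj g := fun g a ha => by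
      rw [hf g a ha]
      exact ofComp_mem _
    refine ⟨ObjectProperty.homMk ⟨f, fun t => dga_hom_ext fun g a ha => ?_⟩,
      GradedDGA.hom_ext fun g a => Subtype.ext (hf g _ (ofComp_mem a))⟩
    change f.toAlgHom (rep A.obj t a) = rep B.obj t (f.toAlgHom a)
    rw [ha.2 t, map_smul, (hf' g a ha).2 t]

end DGAlgPlus

/-! ### The total dg-algebra of a graded dg-algebra -/

namespace GradedDGA

variable {k : Type u} [Field k] {W : Type} [AddCommGroup W] [DecidableEq W]

/-- The direct sum of all homogeneous components. -/
abbrev Total (X : GradedDGA k W) : Type u := DirectSum (ℤ × W) X.X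

namespace Total

variable (X : GradedDGA k W)

/-- The inclusion of a homogeneous component into the direct sum. -/
abbrev of (g : ℤ × W) : X.X g →ₗ[k] X.Total := DirectSum.lof k (ℤ × W) X.X g

variable {X} in
@[elab_as_elim]
theorem induction {p : X.Total → Prop} (a : X.Total) (hzero : p 0) (hof : ∀ g x, p (of X g x))
    (hadd : ∀ a b, p a → p b → p (a + b)) : p a :=
  DirectSum.induction_on a hzero hof hadd

/-- The multiplication of the total algebra as a bilinear map. -/
def mulLinear : X.Total →ₗ[k] X.Total →ₗ[k] X.Total :=
  DirectSum.toModule k _ _ fun g => LinearMap.flip <| DirectSum.toModule k _ _ fun h =>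
    LinearMap.flip <| (X.mul rfl).compr₂ (of X (g + h))

theorem mulLinear_of {g h i : ℤ × W} (e : g + h = i) (x : X.X g) (y : X.X h) :
    mulLinear X (of X g x) (of X h y) = of X i (X.mul e x y) := by
  subst e
  simp [mulLinear]

instance : Mul X.Total := ⟨fun a b => mulLinear X a b⟩

instance : One X.Total := ⟨of X 0 X.one⟩

theorem mul_def (a b : X.Total) : a * b = mulLinear X a b := rfl

theorem one_def : (1 : X.Total) = of X 0 X.one := rfl

theorem of_mul {g h i : ℤ × W} (e : g + h = i) (x : X.X g) (y : X.X h) :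
    of X g x * of X h y = of X i (X.mul e x y) := mulLinear_of X e x y

theorem total_add_mul (a b c : X.Total) : (a + b) * c = a * c + b * c := by
  simp only [mul_def, _root_.map_add, LinearMap.add_apply]

theorem total_mul_add (a b c : X.Total) : a * (b + c) = a * b + a * c := by
  simp only [mul_def, _root_.map_add]

theorem total_zero_mul (a : X.Total) : 0 * a = 0 := by
  simp only [mul_def, _root_.map_zero, LinearMap.zero_apply]

theorem total_mul_zero (a : X.Total) : a * 0 = 0 := by
  simp only [mul_def, _root_.map_zero]

theorem total_one_mul (a : X.Total) : 1 * a = a := by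
  refine induction a (total_mul_zero X _) (fun g x => ?_) fun a b ha hb => by
    rw [total_mul_add, ha, hb]
  rw [one_def, of_mul X (zero_add g), X.one_mul]

theorem total_mul_one (a : X.Total) : a * 1 = a := by
  refine induction a (total_zero_mul X _) (fun g x => ?_) fun a b ha hb => by
    rw [total_add_mul, ha, hb]
  rw [one_def, of_mul X (add_zero g), X.mul_one]

theorem total_mul_assoc (a b c : X.Total) : a * b * c = a * (b * c) := by
  refine induction a (by simp only [total_zero_mul]) (fun g x => ?_) fun a a' h h' => by
    simp only [total_add_mul, h, h']
  refine induction b (by simp only [total_zero_mul, total_mul_zero]) (fun h y => ?_)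
    fun b b' h h' => by simp only [total_add_mul, total_mul_add, h, h']
  refine induction c (by simp only [total_mul_zero]) (fun i z => ?_) fun c c' h h' => by
    simp only [total_mul_add, h, h']
  rw [of_mul X rfl, of_mul X rfl, of_mul X rfl, of_mul X (add_assoc g h i).symm,
    X.mul_assoc rfl rfl rfl (add_assoc g h i).symm]

instance : Ring X.Total where
  left_distrib := total_mul_add X
  right_distrib := total_add_mul X
  zero_mul := total_zero_mul X
  mul_zero := total_mul_zero X
  mul_assoc := total_mul_assoc X
  one_mul := total_one_mul X
  mul_one := total_mul_one X
  sub_eq_add_neg := sub_eq_add_neg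
  zsmul := (· • ·)
  zsmul_zero' := SubNegMonoid.zsmul_zero'
  zsmul_succ' := SubNegMonoid.zsmul_succ'
  zsmul_neg' := SubNegMonoid.zsmul_neg'
  neg_add_cancel := neg_add_cancel

instance : Algebra k X.Total :=
  Algebra.ofModule (fun c a b => by simp only [mul_def, _root_.map_smul, LinearMap.smul_apply])
    (fun c a b => by simp only [mul_def, _root_.map_smul])

/-- The component of the total algebra in a given homological degree. -/
def gr (n : ℕ) : Submodule k X.Total := ⨆ w : W, LinearMap.range (of X ((n : ℤ), w))

variable {X} in
theorem of_mem_gr {g : ℤ × W} {n : ℕ} (h : g.1 = n) (x : X.X g) : of X g x ∈ gr X n := by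
  obtain ⟨m, w⟩ := g
  obtain rfl : m = n := h
  exact Submodule.mem_iSup_of_mem w ⟨x, rfl⟩

variable {X} in
@[elab_as_elim]
theorem gr_induction {n : ℕ} {p : X.Total → Prop} {a : X.Total} (ha : a ∈ gr X n) (hzero : p 0)
    (hof : ∀ g : ℤ × W, g.1 = n → ∀ x, p (of X g x)) (hadd : ∀ a b, p a → p b → p (a + b)) : p a :=
  Submodule.iSup_induction _ (motive := p) ha (fun _ _ ⟨x, hx⟩ => hx ▸ hof _ rfl x) hzero hadd

theorem apply_eq_zero_of_mem_gr {n : ℕ} {a : X.Total} (ha : a ∈ gr X n) {g : ℤ × W}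
    (hg : g.1 ≠ n) : a g = 0 := by
  refine gr_induction ha rfl (fun h hh x => ?_) fun a b ha hb => by
    rw [DirectSum.add_apply, ha, hb, add_zero]
  exact DirectSum.of_eq_of_ne h g x (by rintro rfl; exact hg hh)

theorem isInternal_gr : DirectSum.IsInternal (gr X) := by
  rw [DirectSum.isInternal_submodule_iff_iSupIndep_and_iSup_eq_top]
  constructor
  · rw [iSupIndep_iff_finsetSum_eq_zero_imp_eq_zero]
    intro s v hv h n hn
    refine DFinsupp.ext fun g => ?_
    by_cases hg : g.1 = n
    swap
    · exact apply_eq_zero_of_mem_gr X (hv n hn) hg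
    have h' : (∑ m ∈ s, v m) g = (0 : X.Total) g := by rw [h]
    rw [DFinsupp.finsetSum_apply, Finset.sum_eq_single_of_mem n hn fun m hm hmn =>
      apply_eq_zero_of_mem_gr X (hv m hm) (by rw [hg]; exact_mod_cast hmn.symm)] at h'
    exact h'
  · refine eq_top_iff.2 fun a _ => induction a (zero_mem _) (fun g x => ?_) fun a b => add_mem
    obtain hg | hg := lt_or_ge g.1 0
    · rw [X.eq_zero g hg x, _root_.map_zero]
      exact zero_mem _
    · obtain ⟨n, hn⟩ := Int.eq_ofNat_of_zero_le hg
      exact Submodule.mem_iSup_of_mem n (of_mem_gr hn x)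

instance : GradedAlgebra (gr X) where
  __ := (isInternal_gr X).chooseDecomposition
  one_mem := of_mem_gr rfl _
  mul_mem m n a b ha hb := by
    refine gr_induction ha (by rw [zero_mul]; exact zero_mem _) (fun g hg x => ?_)
      fun a a' h h' => by rw [add_mul]; exact add_mem h h'
    refine gr_induction hb (by rw [mul_zero]; exact zero_mem _) (fun h hh y => ?_)
      fun b b' h h' => by rw [mul_add]; exact add_mem h h'
    rw [of_mul X rfl]
    exact of_mem_gr (by rw [Prod.fst_add, hg, hh]; simp) _

/-- The differential of the total algebra. -/
def d : X.Total →ₗ[k] X.Total :=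
  DirectSum.toModule k _ _ fun g => (of X (g - δ)).comp (X.d (sub_shiftDeg g))

theorem d_of {i j : ℤ × W} (e : j + δ = i) (x : X.X i) : d X (of X i x) = of X j (X.d e x) := by
  obtain rfl : j = i - δ := eq_sub_of_add_eq e
  simp [d]

end Total

/-- The total dg-algebra of a graded dg-algebra. -/
def total (X : GradedDGA k W) : DGAlgPlus k where
  carrier := X.Total
  gr := Total.gr X
  d := Total.d X
  d_mem n a ha := by
    refine Total.gr_induction ha (by rw [_root_.map_zero]; exact zero_mem _) (fun g hg x => ?_)
      fun a b h h' => by rw [_root_.map_add]; exact add_mem h h'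
    rw [Total.d_of X (sub_shiftDeg g)]
    exact Total.of_mem_gr (by simp [hg]) _
  d_zero a ha := by
    refine Total.gr_induction ha (_root_.map_zero _) (fun g hg x => ?_)
      fun a b h h' => by rw [_root_.map_add, h, h', add_zero]
    rw [Total.d_of X (sub_shiftDeg g), X.eq_zero _ (by simp [hg]) (X.d _ x), _root_.map_zero]
  d_d a := by
    refine Total.induction a (by simp only [_root_.map_zero]) (fun g x => ?_)
      fun a b h h' => by rw [_root_.map_add, _root_.map_add, h, h', add_zero]
    rw [Total.d_of X (sub_shiftDeg g), Total.d_of X (sub_shiftDeg _), X.d_d, _root_.map_zero]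
  leibniz n a b ha := by
    refine Total.gr_induction ha (by simp) (fun g hg x => ?_) fun a a' h h' => by
      rw [add_mul, _root_.map_add, h, h', _root_.map_add, add_mul, add_mul, mul_add]
      abel
    refine Total.induction b (by simp) (fun h y => ?_) fun b b' h h' => by
      rw [mul_add, _root_.map_add, h, h', _root_.map_add, mul_add, mul_add, mul_add]
      abel
    have e₁ : g - δ + h = g + h - δ := sub_add_eq_add_sub _ _ _
    have e₂ : g + (h - δ) = g + h - δ := (add_sub_assoc _ _ _).symm
    rw [Total.of_mul X rfl, Total.d_of X (sub_shiftDeg _), Total.d_of X (sub_shiftDeg _),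
      Total.d_of X (sub_shiftDeg _), Total.of_mul X e₁, Total.of_mul X e₂,
      X.leibniz rfl (sub_shiftDeg _) (sub_shiftDeg _) (sub_shiftDeg _) e₁ e₂, hg, zpow_natCast,
      _root_.map_add, _root_.map_smul, Algebra.smul_def, _root_.map_pow, _root_.map_neg,
      _root_.map_one]

/-! ### The rational action on the total dg-algebra -/

section Action

variable {r : ℕ}

namespace Total

/-- An element of the torus acts on the component of weight `w` by the character of weight `w`. -/
def act (X : GradedDGA k (Fin r → ℤ)) (t : AlgTorus k r) : X.Total →ₗ[k] X.Total :=
  DirectSum.lmap fun g => AlgTorus.character g.2 t • LinearMap.id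

variable (X : GradedDGA k (Fin r → ℤ))

theorem act_of (t : AlgTorus k r) (g : ℤ × (Fin r → ℤ)) (x : X.X g) :
    act X t (of X g x) = AlgTorus.character g.2 t • of X g x := by
  rw [act, DirectSum.lmap_lof]
  simp

theorem act_apply (t : AlgTorus k r) (a : X.Total) (g : ℤ × (Fin r → ℤ)) :
    act X t a g = AlgTorus.character g.2 t • a g := by
  rw [act, DirectSum.lmap_apply]
  simp

theorem act_mul (t : AlgTorus k r) (a b : X.Total) : act X t (a * b) = act X t a * act X t b := by
  refine induction a (by simp) (fun g x => ?_) fun a a' h h' => by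
    rw [add_mul, _root_.map_add, h, h', _root_.map_add, add_mul]
  refine induction b (by simp) (fun g' y => ?_) fun b b' h h' => by
    rw [mul_add, _root_.map_add, h, h', _root_.map_add, mul_add]
  rw [act_of, act_of, of_mul X rfl, act_of, smul_mul_smul_comm, of_mul X rfl, Prod.snd_add,
    AlgTorus.character_add]

theorem total_act_one (t : AlgTorus k r) : act X t 1 = 1 := by
  rw [one_def, act_of, Prod.snd_zero, AlgTorus.character_zero, one_smul]

theorem act_d (t : AlgTorus k r) (a : X.Total) : act X t (d X a) = d X (act X t a) := by
  refine induction a (by simp) (fun g x => ?_) fun a a' h h' => by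
    rw [_root_.map_add, _root_.map_add, h, h', _root_.map_add, _root_.map_add]
  rw [act_of, _root_.map_smul, d_of X (sub_shiftDeg g), act_of]
  simp [shiftDeg]

theorem act_mem (t : AlgTorus k r) (n : ℕ) (a : X.Total) (ha : a ∈ gr X n) :
    act X t a ∈ gr X n := by
  refine gr_induction ha (by rw [_root_.map_zero]; exact zero_mem _) (fun g hg x => ?_)
    fun a b h h' => by rw [_root_.map_add]; exact add_mem h h'
  rw [act_of]
  exact Submodule.smul_mem _ _ (of_mem_gr hg x)

/-- The endomorphism of the total dg-algebra by which an element of the torus acts. -/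
def actHom (t : AlgTorus k r) : X.total ⟶ X.total :=
  ({ toAlgHom := AlgHom.ofLinearMap (act X t)
      (total_act_one X t) (act_mul X t)
     map_mem := act_mem X t
     map_d := act_d X t } : DGAlgPlus.Hom X.total X.total)

theorem act_one (a : X.Total) : act X 1 a = a :=
  DFinsupp.ext fun g => by rw [act_apply, AlgTorus.character_one, one_smul]

theorem act_act (s t : AlgTorus k r) (a : X.Total) : act X (s * t) a = act X s (act X t a) :=
  DFinsupp.ext fun g => by rw [act_apply, act_apply, act_apply, AlgTorus.character_mul, mul_smul]

end Total

open Total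

/-- The total dg-algebra with its action of the torus. -/
def totalAction (X : GradedDGA k (Fin r → ℤ)) : Action (DGAlgPlus k) (AlgTorus k r) where
  V := X.total
  ρ :=
    { toFun := actHom X
      map_one' := DGAlgPlus.Hom.ext (AlgHom.ext (act_one X))
      map_mul' := fun s t => DGAlgPlus.Hom.ext (AlgHom.ext (act_act X s t)) }

variable (X : GradedDGA k (Fin r → ℤ))

theorem rep_totalAction (t : AlgTorus k r) (a : X.Total) :
    DGAlgPlus.rep X.totalAction t a = act X t a := rfl

theorem isRational_totalAction : DGAlgPlus.IsRational k r X.totalAction := by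
  intro a
  classical
  let a' : X.Total := a
  let s : Set X.Total := Set.range fun g : a'.support => of X g (a' g)
  let V : Subrepresentation (DGAlgPlus.rep X.totalAction) :=
    { toSubmodule := Submodule.span k s
      apply_mem_toSubmodule := fun t v hv => by
        induction hv using Submodule.span_induction with
        | mem v hv =>
          obtain ⟨g, rfl⟩ := hv
          rw [rep_totalAction, act_of]
          exact Submodule.smul_mem _ _ (Submodule.subset_span ⟨g, rfl⟩)
        | zero => rw [_root_.map_zero]; exact zero_mem _
        | add v w _ _ hv hw => rw [_root_.map_add]; exact add_mem hv hw
        | smul c v _ hv => rw [_root_.map_smul]; exact Submodule.smul_mem _ _ hv }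
  refine ⟨V, ?_, FiniteDimensional.span_of_finite k (Set.finite_range _), fun l v => ?_⟩
  · have h : (∑ g ∈ a'.support, of X g (a' g)) = a' := DirectSum.sum_support_of a'
    change a' ∈ Submodule.span k s
    rw [← h]
    exact Submodule.sum_mem _ fun g hg => Submodule.subset_span ⟨⟨g, hg⟩, rfl⟩
  · obtain ⟨v, hv⟩ := v
    change v ∈ Submodule.span k s at hv
    induction hv using Submodule.span_induction with
    | mem v hv =>
      obtain ⟨g, rfl⟩ := hv
      refine ⟨Finsupp.single g.1.2 (l ⟨of X g (a' g), Submodule.subset_span ⟨g, rfl⟩⟩),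
        fun t => ?_⟩
      rw [Finsupp.sum_single_index (by simp), mul_comm, ← smul_eq_mul, ← _root_.map_smul]
      exact congrArg l (Subtype.ext (act_of X t g _))
    | zero => exact ⟨0, fun t => by
        rw [Finsupp.sum_zero_index, ← _root_.map_zero l]
        exact congrArg l (_root_.map_zero (V.toRepresentation t))⟩
    | add v w hv hw ihv ihw =>
      obtain ⟨P, hP⟩ := ihv
      obtain ⟨Q, hQ⟩ := ihw
      refine ⟨P + Q, fun t => ?_⟩
      rw [Finsupp.sum_add_index' (by simp) (by simp [add_mul]), ← hP, ← hQ, ← _root_.map_add]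
      exact congrArg l (_root_.map_add (V.toRepresentation t) ⟨v, hv⟩ ⟨w, hw⟩)
    | smul c v hv ih =>
      obtain ⟨P, hP⟩ := ih
      refine ⟨c • P, fun t => ?_⟩
      have h : ((c • P).sum fun n b => b * AlgTorus.character n t) =
          c * P.sum fun n b => b * AlgTorus.character n t := by
        rw [Finsupp.sum_smul_index (by simp), Finsupp.mul_sum]
        exact Finsupp.sum_congr fun _ _ => _root_.mul_assoc _ _ _
      rw [h, ← hP, ← smul_eq_mul, ← _root_.map_smul]
      exact congrArg l (_root_.map_smul (V.toRepresentation t) c ⟨v, hv⟩)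

/-- The total dg-algebra with its rational action of the torus. -/
def totalEquivariant : DGAlgPlus.Equivariant k r := ⟨X.totalAction, X.isRational_totalAction⟩

theorem of_mem_comp (g : ℤ × (Fin r → ℤ)) (x : X.X g) :
    of X g x ∈ DGAlgPlus.comp X.totalAction g := by
  refine ⟨?_, fun t => act_of X t g x⟩
  obtain hg | hg := lt_or_ge g.1 0
  · rw [X.eq_zero g hg x, _root_.map_zero]
    exact zero_mem _
  · obtain ⟨n, hn⟩ := Int.eq_ofNat_of_zero_le hg
    rw [hn]
    exact of_mem_gr hn x

variable [CharZero k]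

theorem eq_of_of_mem_comp {g : ℤ × (Fin r → ℤ)} {a : X.Total}
    (ha : a ∈ DGAlgPlus.comp X.totalAction g) : a = of X g (a g) := by
  refine DFinsupp.ext fun h => ?_
  by_cases hgh : g = h
  · subst hgh
    exact (DirectSum.of_eq_same g (a g)).symm
  refine Eq.trans ?_ (DirectSum.of_eq_of_ne g h (a g) (Ne.symm hgh)).symm
  by_contra h0
  refine hgh (Prod.ext ?_ (AlgTorus.characterHom_injective (k := k) (MonoidHom.ext fun t => ?_)))
  · by_contra h₁
    refine h0 ?_
    have hg := ha.1
    obtain ⟨n | n, w⟩ := g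
    · exact apply_eq_zero_of_mem_gr X hg (Ne.symm h₁)
    · rw [(Submodule.mem_bot k).1 hg]
      rfl
  · have h₂ : act X t a = AlgTorus.character g.2 t • a := ha.2 t
    have h₃ := act_apply X t a h
    rw [h₂, DirectSum.smul_apply] at h₃
    exact smul_left_injective k h0 h₃

/-- The canonical morphism (an isomorphism) from a graded dg-algebra to the family of weight spaces
of its total dg-algebra. -/
def toComponents : X ⟶ (DGAlgPlus.components k r).obj X.totalEquivariant :=
  ({ app := fun g => (of X g).codRestrict _ (of_mem_comp X g)
     map_one := rfl
     map_mul := fun e x y => Subtype.ext (of_mul X e x y).symm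
     map_d := fun e x => Subtype.ext (d_of X e x).symm } :
    GradedDGA.Hom X ((DGAlgPlus.components k r).obj X.totalEquivariant))

end Action

end GradedDGA

namespace DGAlgPlus

variable {k : Type u} [Field k] [CharZero k] {r : ℕ}

instance : (components k r).EssSurj where
  mem_essImage X := by
    have : IsIso X.toComponents := GradedDGA.isIso_of_bijective _ fun g =>
      ⟨fun x y h => DirectSum.of_injective g (congrArg ofComp h),
        fun a => ⟨(show X.Total from ofComp a) g,
          Subtype.ext (X.eq_of_of_mem_comp (ofComp_mem a)).symm⟩⟩
    exact ⟨X.totalEquivariant, ⟨(asIso X.toComponents).symm⟩⟩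

instance : (components k r).IsEquivalence where

end DGAlgPlus

namespace DGAlgPlus

variable {k : Type u} [Field k]

/-! ### Fibrations and weak equivalences in terms of weight spaces -/

section GradedFamily

variable {W : Type} [AddCommGroup W] {B C : DGAlgPlus k} {S : ℤ × W → Submodule k B}
  {S' : ℤ × W → Submodule k C} {hS : IsGradedFamily B S} {hS' : IsGradedFamily C S'} {f : B ⟶ C}
  {hf : ∀ g, ∀ a ∈ S g, f.toAlgHom a ∈ S' g}

theorem IsGradedFamily.weq_map_iff : GradedDGA.weq k W (hS.map hS' f hf) ↔ ∀ (n : ℕ) (w : W),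
    (∀ a ∈ S ((n : ℤ), w), B.d a = 0 → (∃ b ∈ S' ((n : ℤ) + 1, w), C.d b = f.toAlgHom a) →
      ∃ x ∈ S ((n : ℤ) + 1, w), B.d x = a) ∧
    ∀ b ∈ S' ((n : ℤ), w), C.d b = 0 → ∃ a ∈ S ((n : ℤ), w), ∃ y ∈ S' ((n : ℤ) + 1, w),
      B.d a = 0 ∧ b = f.toAlgHom a + C.d y := by
  constructor
  · intro h n w
    obtain ⟨h₁, h₂⟩ := h (h := ((n : ℤ) + 1, w)) (i := ((n : ℤ), w)) (j := ((n : ℤ) - 1, w))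
      (by simp [shiftDeg]) (by simp [shiftDeg])
    refine ⟨fun a ha hda ⟨b, hb, hab⟩ => ?_, fun b hb hdb => ?_⟩
    · obtain ⟨x, hx⟩ := h₁ ⟨a, ha⟩ (Subtype.ext hda) ⟨⟨b, hb⟩, Subtype.ext hab⟩
      exact ⟨x.1, x.2, congrArg Subtype.val hx⟩
    · obtain ⟨a, y, ha, hab⟩ := h₂ ⟨b, hb⟩ (Subtype.ext hdb)
      exact ⟨a.1, a.2, y.1, y.2, congrArg Subtype.val ha, congrArg Subtype.val hab⟩
  · rintro H h ⟨m, w⟩ j e e'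
    obtain hm | hm := lt_or_ge m 0
    · refine ⟨fun a _ _ => ⟨0, ?_⟩, fun b _ => ⟨0, 0, _root_.map_zero _, ?_⟩⟩
      · exact (_root_.map_zero _).trans (hS.toGradedDGA.eq_zero (m, w) hm a).symm
      · rw [hS'.toGradedDGA.eq_zero (m, w) hm b, _root_.map_zero, _root_.map_zero, add_zero]
    obtain ⟨n, rfl⟩ := Int.eq_ofNat_of_zero_le hm
    obtain rfl : ((n : ℤ) + 1, w) = h := by rw [← e]; simp [shiftDeg]
    obtain ⟨h₁, h₂⟩ := H n w
    refine ⟨fun a hda ⟨b, hab⟩ => ?_, fun b hdb => ?_⟩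
    · obtain ⟨x, hx, hxa⟩ := h₁ a.1 a.2 (congrArg Subtype.val hda)
        ⟨b.1, b.2, congrArg Subtype.val hab⟩
      exact ⟨⟨x, hx⟩, Subtype.ext hxa⟩
    · obtain ⟨a, ha, y, hy, hda, hab⟩ := h₂ b.1 b.2 (congrArg Subtype.val hdb)
      exact ⟨⟨a, ha⟩, ⟨y, hy⟩, Subtype.ext hda, Subtype.ext hab⟩

theorem IsGradedFamily.fib_map_iff : GradedDGA.fib k W (hS.map hS' f hf) ↔ ∀ n : ℕ, 0 < n →
    ∀ w : W, ∀ b ∈ S' ((n : ℤ), w), ∃ a ∈ S ((n : ℤ), w), f.toAlgHom a = b := by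
  constructor
  · intro h n hn w b hb
    obtain ⟨a, ha⟩ := h ((n : ℤ), w) (Int.natCast_pos.2 hn) ⟨b, hb⟩
    exact ⟨a.1, a.2, congrArg Subtype.val ha⟩
  · rintro h ⟨m, w⟩ hm b
    obtain ⟨n, rfl⟩ := Int.eq_ofNat_of_zero_le hm.le
    obtain ⟨a, ha, hab⟩ := h n (Int.natCast_pos.1 hm) w b.1 b.2
    exact ⟨⟨a, ha⟩, Subtype.ext hab⟩

end GradedFamily

/-- The functor `cofree` preserves acyclic fibrations; hence its left adjoint preserves
cofibrations. -/
theorem tfib_cofreeMap (W : Type) [AddCommGroup W] {B C : DGAlgPlus k} {f : B ⟶ C}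
    (hw : weq k f) (hf : fib k f) : GradedDGA.tfib k W (cofreeMap W f) :=
  (GradedDGA.tfib_iff _).2 ⟨IsGradedFamily.weq_map_iff.2 fun n _ => (weq_iff f).1 hw n,
    IsGradedFamily.fib_map_iff.2 fun n hn _ => hf n hn⟩

section Projection

variable {r : ℕ}

theorem comp_natCast_le {A : Action (DGAlgPlus k) (AlgTorus k r)} (n : ℕ) (w : Fin r → ℤ) :
    comp A ((n : ℤ), w) ≤ A.V.gr n :=
  inf_le_left

theorem comp_natCast_add_one_le {A : Action (DGAlgPlus k) (AlgTorus k r)} (n : ℕ)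
    (w : Fin r → ℤ) : comp A ((n : ℤ) + 1, w) ≤ A.V.gr (n + 1) :=
  inf_le_left

variable [CharZero k]

/-- The projection of a dg-algebra with a rational action onto its space of vectors of weight
`w`. -/
def weightProj (A : Equivariant k r) (w : Fin r → ℤ) : A.obj.V →ₗ[k] A.obj.V :=
  glue A.property fun g => if g.2 = w then (comp A.obj g).subtype else 0

variable {A B : Equivariant k r} {w : Fin r → ℤ}

theorem weightProj_same {n : ℤ} {a : A.obj.V} (ha : a ∈ comp A.obj (n, w)) :
    weightProj A w a = a := by
  rw [weightProj, glue_coe A.property _ (n, w) ⟨a, ha⟩, if_pos rfl]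
  rfl

theorem weightProj_ne {g : ℤ × (Fin r → ℤ)} (hg : g.2 ≠ w) {a : A.obj.V}
    (ha : a ∈ comp A.obj g) : weightProj A w a = 0 := by
  rw [weightProj, glue_coe A.property _ g ⟨a, ha⟩, if_neg hg]
  rfl

theorem weightProj_mem {n : ℕ} {a : A.obj.V} (ha : a ∈ A.obj.V.gr n) :
    weightProj A w a ∈ comp A.obj ((n : ℤ), w) := by
  refine Submodule.iSup_induction _ (motive := fun a => weightProj A w a ∈ comp A.obj ((n : ℤ), w))
    (gr_le_iSup_comp A.property n ha) (fun w' a ha => ?_) (by rw [map_zero]; exact zero_mem _)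
    fun a b ha hb => by rw [map_add]; exact add_mem ha hb
  by_cases h : w' = w
  · subst h
    rwa [weightProj_same ha]
  · rw [weightProj_ne h ha]
    exact zero_mem _

theorem weightProj_comm {M : A.obj.V →ₗ[k] B.obj.V} (e : ℤ)
    (hM : ∀ n w, ∀ a ∈ comp A.obj (n, w), M a ∈ comp B.obj (n + e, w)) (a : A.obj.V) :
    weightProj B w (M a) = M (weightProj A w a) := by
  refine comp_induction A.property (p := fun a => weightProj B w (M a) = M (weightProj A w a)) a
    (fun g a ha => ?_) (by simp) fun a b ha hb => by simp only [map_add, ha, hb]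
  by_cases h : g.2 = w
  · subst h
    rw [weightProj_same ha, weightProj_same (hM _ _ a ha)]
  · rw [weightProj_ne h ha, weightProj_ne (g := (g.1 + e, g.2)) h (hM _ _ a ha), map_zero]

theorem weightProj_d (a : A.obj.V) :
    weightProj A w (A.obj.V.d a) = A.obj.V.d (weightProj A w a) :=
  weightProj_comm (-1) (fun n w a ha =>
    (isGradedFamily_comp A.obj).d_mem (g := (n + -1, w)) (by simpa [shiftDeg] using ha)) a

theorem weightProj_map (f : A ⟶ B) (a : A.obj.V) :
    weightProj B w (f.hom.hom.toAlgHom a) = f.hom.hom.toAlgHom (weightProj A w a) :=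
  weightProj_comm (M := f.hom.hom.toAlgHom.toLinearMap) 0
    (fun n w a ha => by rw [add_zero]; exact map_mem_comp f.hom ha) a

/-- An element is a finite sum of its projections to the weight spaces. -/
theorem mem_of_weightProj_mem {S : Submodule k A.obj.V} {a : A.obj.V}
    (h : ∀ w, weightProj A w a ∈ S) : a ∈ S := by
  classical
  have hs : ∃ s : Finset (Fin r → ℤ), ∀ s', s ⊆ s' → ∑ w ∈ s', weightProj A w a = a := by
    refine comp_induction A.property
      (p := fun a => ∃ s : Finset (Fin r → ℤ), ∀ s', s ⊆ s' → ∑ w ∈ s', weightProj A w a = a) a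
      (fun g a ha => ⟨{g.2}, fun s' hs' => ?_⟩) ⟨∅, by simp⟩ fun a b ⟨s, hs⟩ ⟨t, ht⟩ =>
        ⟨s ∪ t, fun s' hs' => ?_⟩
    · rw [Finset.sum_eq_single_of_mem g.2 (hs' (Finset.mem_singleton_self _))
        fun w _ hw => weightProj_ne hw.symm ha, weightProj_same ha]
    · simp only [map_add, Finset.sum_add_distrib]
      rw [hs s' (Finset.union_subset_left hs'), ht s' (Finset.union_subset_right hs')]
  obtain ⟨s, hs⟩ := hs
  rw [← hs s subset_rfl]
  exact Submodule.sum_mem _ fun w _ => h w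

theorem weq_components_iff (f : A ⟶ B) :
    GradedDGA.weq k _ ((components k r).map f) ↔ weq k ((forgetAction k r).map f) := by
  rw [weq_iff]
  refine IsGradedFamily.weq_map_iff.trans (forall_congr' fun n => ?_)
  change _ ↔ (∀ a ∈ A.obj.V.gr n, A.obj.V.d a = 0 →
      (∃ b ∈ B.obj.V.gr (n + 1), B.obj.V.d b = f.hom.hom.toAlgHom a) →
        ∃ x ∈ A.obj.V.gr (n + 1), A.obj.V.d x = a) ∧
    ∀ b ∈ B.obj.V.gr n, B.obj.V.d b = 0 → ∃ a ∈ A.obj.V.gr n, ∃ y ∈ B.obj.V.gr (n + 1),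
      A.obj.V.d a = 0 ∧ b = f.hom.hom.toAlgHom a + B.obj.V.d y
  refine ⟨fun h => ⟨fun a ha hda ⟨b, hb, hab⟩ => ?_, fun b hb hdb => ?_⟩, fun h w =>
    ⟨fun a ha hda ⟨b, hb, hab⟩ => ?_, fun b hb hdb => ?_⟩⟩
  · refine mem_of_weightProj_mem (S := (A.obj.V.gr (n + 1)).map A.obj.V.d) fun w => ?_
    obtain ⟨x, hx, hxa⟩ := (h w).1 (weightProj A w a) (weightProj_mem ha)
      (by rw [← weightProj_d, hda, map_zero])
      ⟨weightProj B w b, weightProj_mem (n := n + 1) hb,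
        by rw [← weightProj_d, hab, weightProj_map]⟩
    exact ⟨x, comp_natCast_add_one_le n w hx, hxa⟩
  · have : b ∈ (A.obj.V.gr n ⊓ LinearMap.ker A.obj.V.d).map f.hom.hom.toAlgHom.toLinearMap ⊔
        (B.obj.V.gr (n + 1)).map B.obj.V.d := by
      refine mem_of_weightProj_mem fun w => ?_
      obtain ⟨a, ha, y, hy, hda, hab⟩ := (h w).2 (weightProj B w b) (weightProj_mem hb)
        (by rw [← weightProj_d, hdb, map_zero])
      rw [hab]
      exact Submodule.add_mem_sup ⟨a, ⟨comp_natCast_le n w ha, hda⟩, rfl⟩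
        ⟨y, comp_natCast_add_one_le n w hy, rfl⟩
    obtain ⟨-, ⟨a, ⟨ha, hda⟩, rfl⟩, -, ⟨y, hy, rfl⟩, hab⟩ := Submodule.mem_sup.1 this
    exact ⟨a, ha, y, hy, hda, hab.symm⟩
  · obtain ⟨x, hx, hxa⟩ := h.1 a (comp_natCast_le n w ha) hda
      ⟨b, comp_natCast_add_one_le n w hb, hab⟩
    exact ⟨weightProj A w x, weightProj_mem (n := n + 1) hx,
      by rw [← weightProj_d, hxa, weightProj_same ha]⟩
  · obtain ⟨a, ha, y, hy, hda, hab⟩ := h.2 b (comp_natCast_le n w hb) hdb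
    refine ⟨weightProj A w a, weightProj_mem ha, weightProj B w y, weightProj_mem (n := n + 1) hy,
      by rw [← weightProj_d, hda, map_zero], ?_⟩
    rw [← weightProj_d, ← weightProj_map, ← map_add, ← hab, weightProj_same hb]

theorem fib_components_iff (f : A ⟶ B) :
    GradedDGA.fib k _ ((components k r).map f) ↔ fib k ((forgetAction k r).map f) := by
  refine IsGradedFamily.fib_map_iff.trans (forall_congr' fun n => forall_congr' fun hn => ?_)
  change _ ↔ ∀ b ∈ B.obj.V.gr n, ∃ a ∈ A.obj.V.gr n, f.hom.hom.toAlgHom a = b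
  refine ⟨fun h b hb => ?_, fun h w b hb => ?_⟩
  · refine mem_of_weightProj_mem
      (S := (A.obj.V.gr n).map f.hom.hom.toAlgHom.toLinearMap) fun w => ?_
    obtain ⟨a, ha, hab⟩ := h w (weightProj B w b) (weightProj_mem hb)
    exact ⟨a, comp_natCast_le n w ha, hab⟩
  · obtain ⟨a, ha, hab⟩ := h b (comp_natCast_le n w hb)
    exact ⟨weightProj A w a, weightProj_mem ha, by rw [← weightProj_map, hab, weightProj_same hb]⟩

end Projection

/-! ### The model structure on dg-algebras with a rational action -/

variable (k) [CharZero k] (r : ℕ)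

theorem weq_inverseImage : (weq k).inverseImage (forgetAction k r) =
    (GradedDGA.weq k _).inverseImage (components k r) := by
  ext A B f
  exact (weq_components_iff f).symm

theorem fib_inverseImage : (fib k).inverseImage (forgetAction k r) =
    (GradedDGA.fib k _).inverseImage (components k r) := by
  ext A B f
  exact (fib_components_iff f).symm

theorem weq_inf_fib_inverseImage : (weq k ⊓ fib k).inverseImage (forgetAction k r) =
    (GradedDGA.tfib k _).inverseImage (components k r) := by
  rw [GradedDGA.tfib_eq]
  exact congrArg₂ (· ⊓ ·) (weq_inverseImage k r) (fib_inverseImage k r)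

/-- An equivalence of categories identifies the left lifting properties. -/
theorem llp_inverseImage : ((weq k ⊓ fib k).inverseImage (forgetAction k r)).llp =
    (GradedDGA.cof k _).inverseImage (components k r) := by
  rw [weq_inf_fib_inverseImage]
  ext A B f
  constructor
  · intro hf X Y p hp
    let e := (components k r).asEquivalence
    let q : e.inverse.obj X ⟶ e.inverse.obj Y := e.inverse.map p
    let i : Arrow.mk ((components k r).map q) ≅ Arrow.mk p :=
      Arrow.isoMk (e.counitIso.app X) (e.counitIso.app Y) (e.counitIso.hom.naturality p).symm
    have hq : GradedDGA.tfib k _ ((components k r).map q) :=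
      GradedDGA.of_retract_tfib i.retract hp
    have := ((components k r).hasLiftingProperty_iff_of_isEquivalence f q).2 (hf q hq)
    exact HasLiftingProperty.of_arrow_iso_right _ i
  · intro hf X Y p hp
    exact ((components k r).hasLiftingProperty_iff_of_isEquivalence f p).1 (hf _ hp)

instance : CategoryWithFibrations (Equivariant k r) :=
  ⟨(fib k).inverseImage (forgetAction k r)⟩
instance : CategoryWithCofibrations (Equivariant k r) :=
  ⟨((weq k ⊓ fib k).inverseImage (forgetAction k r)).llp⟩
instance : CategoryWithWeakEquivalences (Equivariant k r) :=
  ⟨(weq k).inverseImage (forgetAction k r)⟩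

instance : ModelCategory (Equivariant k r) :=
  ModelCategory.transport (components k r).asEquivalence (llp_inverseImage k r)
    (fib_inverseImage k r) (weq_inverseImage k r)

variable {k r}

/-- The underlying morphism of a cofibration lifts against an acyclic fibration `p`, since by
adjunction the morphism between the weight spaces lifts against `cofreeMap p`. -/
theorem cof_of_cof_components {A B : Equivariant k r} (f : A ⟶ B)
    (hf : GradedDGA.cof k _ ((components k r).map f)) : cof k ((forgetAction k r).map f) := by
  intro X Y p hp
  have hp' := tfib_cofreeMap (Fin r → ℤ) hp.1 hp.2
  refine ⟨fun {u v} sq => ?_⟩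
  have hsq : ∀ a : A.obj.V, p.toAlgHom (u.toAlgHom a) = v.toAlgHom (f.hom.hom.toAlgHom a) :=
    fun a => congrArg (fun φ : Hom A.obj.V Y => φ.toAlgHom a) sq.w
  have sq' : CommSq (ascend u) ((components k r).map f) (cofreeMap _ p) (ascend v) :=
    ⟨GradedDGA.hom_ext fun g a => Subtype.ext (hsq (ofComp a))⟩
  have := hf _ hp'
  refine ⟨⟨⟨descend sq'.lift, ?_, ?_⟩⟩⟩
  · refine dga_hom_ext fun g a ha => ?_
    refine (descend_apply sq'.lift (map_mem_comp f.hom ha)).trans ?_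
    exact congrArg ofCofree (GradedDGA.congr_app sq'.fac_left g (toComp A a ha))
  · refine dga_hom_ext fun g b hb => ?_
    refine (congrArg p.toAlgHom (descend_apply sq'.lift hb)).trans ?_
    exact congrArg ofCofree (GradedDGA.congr_app sq'.fac_right g (toComp B b hb))

end DGAlgPlus

end

theorem theorem2p15 (k : Type u) [Field k] [CharZero k] (r : ℕ) :
    ∃ M : ModelCategory (DGAlgPlus.Equivariant k r),
      @weakEquivalences _ _ M.categoryWithWeakEquivalences =
        (DGAlgPlus.weq k).inverseImage (DGAlgPlus.forgetAction k r) ∧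
      @fibrations _ _ M.categoryWithFibrations =
        (DGAlgPlus.fib k).inverseImage (DGAlgPlus.forgetAction k r) ∧
      @cofibrations _ _ M.categoryWithCofibrations =
        ((DGAlgPlus.weq k ⊓ DGAlgPlus.fib k).inverseImage (DGAlgPlus.forgetAction k r)).llp ∧
      @cofibrations _ _ M.categoryWithCofibrations ≤
        (DGAlgPlus.cof k).inverseImage (DGAlgPlus.forgetAction k r) := by
  refine ⟨inferInstance, rfl, rfl, rfl, fun A B f hf => ?_⟩
  exact DGAlgPlus.cof_of_cof_components f
    ((congrFun (congrFun (congrFun (DGAlgPlus.llp_inverseImage k r) A) B) f).mp hf)
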